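/- Let $\mathbb D$ be the open unit disc, $\mathbb T$ the unit circle and $m$ normalized Lebesgue measure on $\mathbb T$. Let $a_0,a_1,\dots\in\mathbb D$, put $$B_k(z)=\prod_{j=0}^{k-1}\frac{z-a_j}{1-z\overline{a_j}},\qquad \varphi_k(z)=\frac{\sqrt{1-|a_k|^2}}{1-z\overline{a_k}}\,B_k(z)\qquad(k\ge 0)$$ (the Takenaka–Malmquist system), and for $n\ge 1$ $$S_n(f)=\sum_{k=0}^{n-1}\Big(\int_{\mathbb T}f\,\overline{\varphi_k}\,dm\Big)\varphi_k,\qquad \sigma^+_{n,\varphi}(f)(z)=S_n(f)(z)-\frac{B_n(z)}{B_n'(z)}\,S_n(f)'(z)\quad(z\in\mathbb T),$$ $$\gamma_n(t)=\frac12\sum_{k=0}^{n-1}\frac{1-|a_k|^2}{1-2|a_k|\cos(t-\arg a_k)+|a_k|^2},\qquad \sigma_{n,\varphi}(f)(e^{ix})=\frac{1}{4\pi\gamma_n(x)}\int_{-\pi}^{\pi}f(e^{iy})\,\frac{\sin^2\!\big(\int_x^y\gamma_n(t)\,dt\big)}{\sin^2\frac{y-x}{2}}\,dy .$$ Let $f\in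 H^\infty$, that is, $f$ is bounded and holomorphic in $\mathbb D$. Then $f$ has a non-tangential limit at $m$-almost every point of $\mathbb T$; denote the resulting boundary function on $\mathbb T$ again by $f$. For every $n\ge 1$, $$\|f-\sigma^+_{n,\varphi}(f)\|_{L^\infty(\mathbb T)}\ \ge\ \frac1n\max_{0\le j\le n-1}\big(1-|a_j|^2\big)\,|f'(a_j)| .$$ Moreover, if $\sum_{k=0}^\infty(1-|a_k|)=+\infty$ and $\|f-\sigma_{n,\varphi}(f)\|_{L^\infty(\mathbb T)}=o(1/n)$ as $n\to\infty$, then $f$ is constant. -/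

import Mathlib

open scoped ENNReal Topology ComplexConjugate

noncomputable section

namespace TM

/-- `f` belongs to the Hardy space `H^∞`: it is holomorphic and bounded in the open unit disc. -/
structure MemHInfty (f : ℂ → ℂ) : Prop where
  differentiableOn : DifferentiableOn ℂ f (Metric.ball 0 1)
  bounded : ∃ C : ℝ, ∀ z ∈ Metric.ball (0 : ℂ) 1, ‖f z‖ ≤ C

/-- `f` has the non-tangential limit `w` at the point `t` of the unit circle: it tends to `w`
along every Stolz angle `{t z : |z| < 1, |1 - z| < M (1 - |z|)}` with vertex `t`. -/
def HasNontangentialLimit (f : ℂ → ℂ) (t : Circle) (w : ℂ) : Prop :=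
  ∀ M : ℝ, Filter.Tendsto (fun z : ℂ => f (t * z)) (𝓝[Complex.stolzSet M] 1) (𝓝 w)

open Classical in
/-- The boundary function of `f`: its non-tangential limit at each point of the circle where it
exists (and `0` elsewhere). -/
def boundary (f : ℂ → ℂ) (t : Circle) : ℂ :=
  if h : ∃ w, HasNontangentialLimit f t w then h.choose else 0

instance : MeasurableSpace Circle := borel Circle

instance : BorelSpace Circle := ⟨rfl⟩

/-- Normalized Lebesgue measure `m` on the unit circle. -/
def circleMeasure : MeasureTheory.Measure Circle :=
  (ENNReal.ofReal (2 * Real.pi))⁻¹ •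
    (MeasureTheory.volume.restrict (Set.Ioc (-Real.pi) Real.pi)).map Circle.exp

/-- The finite Blaschke product `B_k` with zeros `a_0, …, a_{k-1}`. -/
def blaschke (a : ℕ → ℂ) (k : ℕ) (z : ℂ) : ℂ :=
  ∏ j ∈ Finset.range k, (z - a j) / (1 - z * conj (a j))

/-- The Takenaka--Malmquist function `φ_k` associated with the points `a`. -/
def phi (a : ℕ → ℂ) (k : ℕ) (z : ℂ) : ℂ :=
  ((Real.sqrt (1 - ‖a k‖ ^ 2) : ℝ) : ℂ) / (1 - z * conj (a k)) * blaschke a k z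

/-- The Fourier coefficient `⟨g, φ_k⟩ = ∫ g \overline{φ_k} dm`. -/
def coeff (a : ℕ → ℂ) (g : Circle → ℂ) (k : ℕ) : ℂ :=
  ∫ t : Circle, g t * conj (phi a k t) ∂circleMeasure

/-- The partial sum `S_n(g) = ∑_{k < n} ⟨g, φ_k⟩ φ_k`, as a function of a complex variable. -/
def partialSum (a : ℕ → ℂ) (n : ℕ) (g : Circle → ℂ) (z : ℂ) : ℂ :=
  ∑ k ∈ Finset.range n, coeff a g k * phi a k z

/-- The operator `σ⁺_{n,φ}` on the circle, `S_n - (B_n / B_n') S_n'`. -/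
def sigmaPlus (a : ℕ → ℂ) (n : ℕ) (g : Circle → ℂ) (z : Circle) : ℂ :=
  if n = 0 then g z
  else partialSum a n g z -
    blaschke a n z / deriv (blaschke a n) z * deriv (partialSum a n g) z

/-- The phase density `γ_n`. -/
def gamma (a : ℕ → ℂ) (n : ℕ) (t : ℝ) : ℝ :=
  1 / 2 * ∑ k ∈ Finset.range n,
    (1 - ‖a k‖ ^ 2) / (1 - 2 * ‖a k‖ * Real.cos (t - Complex.arg (a k)) + ‖a k‖ ^ 2)

/-- The value of Rusak's integral operator at `e^{ix}`, for a real angle `x`. -/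
def rusakAt (a : ℕ → ℂ) (n : ℕ) (g : Circle → ℂ) (x : ℝ) : ℂ :=
  if n = 0 then g (Circle.exp x)
  else ((1 / (4 * Real.pi * gamma a n x) : ℝ) : ℂ) *
    ∫ y in (-Real.pi)..Real.pi, g (Circle.exp y) *
      ((Real.sin (∫ t in x..y, gamma a n t) ^ 2 / Real.sin ((y - x) / 2) ^ 2 : ℝ) : ℂ)

/-- The Fejér-type operator `σ_{n,φ}` as an operator on functions on the circle. The value of
`rusakAt` depends on the angle only modulo `2π`, so the principal argument may be used. -/
def sigma (a : ℕ → ℂ) (n : ℕ) (g : Circle → ℂ) (z : Circle) : ℂ :=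
  rusakAt a n g (Complex.arg z)

end TM

end

/-! Write `g` for the boundary function of `f`. The engine is the decomposition `f = S_n + B_n h`
with `h` bounded and holomorphic (`HasBoundary.exists_eq_partialSum_add`): `S_n` interpolates `f` at
the zeros of `B_n`. Put `F = h B_n' + S_n'`. In the disc `F = f' - B_n h'`, while almost everywhere
on the circle `g - σ⁺ = (B_n / B_n') F`. There `|B_n| = 1` and `|B_n'| = ∑ |φ_k|²`, which has
integral `n` by orthonormality, so the `L¹` norm of `F` is at most `n ‖g - σ⁺‖_∞`. A weighted Cauchy
formula bounds `(1 - |w|²) |F(w)|` by that norm (`HasBoundary.norm_deriv_sub_le`). At `w = a_j` the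
product `B_n` vanishes and `F(a_j) = f'(a_j)`: this is the inequality.

For the second claim, Rusak's operator agrees with `σ⁺` on such `g` (`sigma_eq_sigmaPlus`). The
phase of `B_n` is `2 ∫ γ_n`, so by Christoffel–Darboux the sine quotient is `|K|²`, where `K` is the
reproducing kernel of the span of the `φ_k`, `k < n`. In `∫ g |K|²` the remainder `B_n h`
contributes nothing, and the reproducing property evaluates the rest. Hence the hypothesis forces
`f'(w) - B_n(w) h_n'(w) → 0`. Divergence of `∑ (1 - |a_k|)` gives `B_n(w) → 0`, and `h_n'(w)` is
bounded in `n` (`HasBoundary.norm_remainder_le` and Cauchy's estimate), so `f' = 0`.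

Fatou's theorem comes from a primitive of `f`: it is Lipschitz, hence differentiable almost
everywhere along the circle. At such a point a maximum principle carries the limit of the difference
quotients into the disc, and Cauchy's estimate turns it into a nontangential limit of the
derivative. -/

namespace TM

open scoped NNReal

open MeasureTheory Filter Metric Set

/-! ### Fatou's theorem on nontangential limits -/

/-- A bounded holomorphic function on the disc which is continuous up to the boundary except at `1`
and bounded by `ε` on the rest of the circle is bounded by `ε`. -/
theorem norm_le_of_norm_le_on_circle_diff_one {P : ℂ → ℂ} {C ε : ℝ} (hε : 0 < ε)
    (hP : DifferentiableOn ℂ P (ball 0 1))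
    (hc : ∀ z ∈ closedBall (0 : ℂ) 1, z ≠ 1 → ContinuousAt P z)
    (hC : ∀ z ∈ closedBall (0 : ℂ) 1, z ≠ 1 → ‖P z‖ ≤ C)
    (hb : ∀ z ∈ sphere (0 : ℂ) 1, z ≠ 1 → ‖P z‖ ≤ ε) :
    ∀ z ∈ ball (0 : ℂ) 1, ‖P z‖ ≤ ε := by
  intro z hz
  have hz1 : z ≠ 1 := by rintro rfl; simp at hz
  -- The factor `z - 1` absorbs the possible discontinuity at `1`. On the circle it costs a factor
  -- `2` that does not depend on `m`, so large powers of `P` make it irrelevant.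
  have key : ∀ m : ℕ, ‖P z‖ ^ m * ‖z - 1‖ ≤ 2 * ε ^ m := by
    intro m
    have hW : DiffContOnCl ℂ (fun w => P w ^ m * (w - 1)) (ball 0 1) := by
      refine ⟨(hP.pow m).mul (by fun_prop), ?_⟩
      rw [closure_ball _ one_ne_zero]
      intro w hw
      by_cases h1 : w = 1
      · subst h1
        have : Tendsto (fun w : ℂ => P w ^ m * (w - 1)) (𝓝[closedBall 0 1] 1) (𝓝 0) := by
          refine squeeze_zero_norm' (a := fun w : ℂ => C ^ m * ‖w - 1‖) ?_ ?_
          · filter_upwards [self_mem_nhdsWithin] with w hw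
            rw [norm_mul, norm_pow]
            by_cases h : w = 1
            · simp [h]
            · gcongr
              exact hC w hw h
          · have : Continuous (fun w : ℂ => C ^ m * ‖w - 1‖) := by fun_prop
            simpa using (this.tendsto 1).mono_left nhdsWithin_le_nhds
        simpa [ContinuousWithinAt] using this
      · exact (((hc w hw h1).pow m).mul (by fun_prop)).continuousWithinAt
    have := Complex.norm_le_of_forall_mem_frontier_norm_le isBounded_ball hW
      (C := 2 * ε ^ m) ?_ (subset_closure hz)
    · simpa using this
    · intro w hw
      rw [frontier_ball _ one_ne_zero] at hw
      have hw' : ‖w‖ = 1 := by simpa using hw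
      by_cases h1 : w = 1
      · simp [h1]; positivity
      · rw [norm_mul, norm_pow, mul_comm]
        gcongr
        · calc ‖w - 1‖ ≤ ‖w‖ + ‖(1 : ℂ)‖ := norm_sub_le _ _
            _ = 2 := by rw [hw']; norm_num
        · exact hb w hw h1
  by_contra! hlt
  have hq : 1 < ‖P z‖ / ε := by rwa [one_lt_div hε]
  have hd : 0 < ‖z - 1‖ := norm_pos_iff.2 (sub_ne_zero.2 hz1)
  obtain ⟨m, hm⟩ := pow_unbounded_of_one_lt (2 / ‖z - 1‖) hq
  have := key m
  rw [div_pow, div_lt_div_iff₀ hd (by positivity)] at hm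
  linarith

/-- The parallelogram law makes `(1 + z) / 2` a quantitative peak function at `1`: its modulus is at
most `1`, and bounded away from `1` off any neighbourhood of that point. -/
theorem norm_one_add_div_two_sq_le {z : ℂ} (hz : ‖z‖ ≤ 1) :
    ‖(1 + z) / 2‖ ^ 2 ≤ 1 - ‖z - 1‖ ^ 2 / 4 := by
  have h := parallelogram_law_with_norm ℝ (1 : ℂ) z
  rw [norm_sub_rev 1 z, norm_one] at h
  rw [norm_div, div_pow]
  have : ‖(2 : ℂ)‖ = 2 := by simp
  rw [this]
  have := norm_nonneg z
  nlinarith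

/-- A bounded holomorphic function on the disc, continuous up to the boundary except at `1` and
tending to `0` along the circle at `1`, tends to `0` at `1` from within the disc. -/
theorem tendsto_zero_of_tendsto_zero_on_circle {Q : ℂ → ℂ} {C : ℝ}
    (hQ : DifferentiableOn ℂ Q (ball 0 1))
    (hc : ∀ z ∈ closedBall (0 : ℂ) 1, z ≠ 1 → ContinuousAt Q z)
    (hC : ∀ z ∈ closedBall (0 : ℂ) 1, z ≠ 1 → ‖Q z‖ ≤ C)
    (hb : Tendsto Q (𝓝[sphere 0 1 \ {1}] 1) (𝓝 0)) :
    Tendsto Q (𝓝[ball 0 1] 1) (𝓝 0) := by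
  have hC0 : 0 ≤ C := (norm_nonneg _).trans (hC 0 (by simp) (by simp))
  rw [Metric.tendsto_nhds]
  intro ε hε
  obtain ⟨δ, hδ, hδb⟩ := Metric.mem_nhdsWithin_iff.1
    (Metric.tendsto_nhds.1 hb (ε / 4) (by positivity))
  set q : ℝ := √(1 - min δ 1 ^ 2 / 4) with hq
  have hm0 : 0 < min δ 1 := by positivity
  have hm1 : min δ 1 ≤ 1 := min_le_right _ _
  have hq1 : q < 1 := by
    rw [hq, Real.sqrt_lt' one_pos]
    nlinarith [pow_pos hm0 2]
  have hq0 : 0 ≤ q := Real.sqrt_nonneg _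
  -- Multiplying `Q` by the `N`-th power of the peak function makes it at most `ε / 4` on the far
  -- arc, where `‖Q‖ ≤ C`, and leaves it small on the near arc. Close to `1` the power still exceeds
  -- `1 / 2`, so dividing it out loses only a factor `2`.
  obtain ⟨N, hN⟩ := exists_pow_lt_of_lt_one (show 0 < ε / 4 / (C + 1) by positivity) hq1
  have hpk : ∀ z : ℂ, ‖z‖ ≤ 1 → ‖(1 + z) / 2‖ ≤ 1 := by
    intro z hz
    have := norm_one_add_div_two_sq_le hz
    nlinarith [norm_nonneg ((1 + z) / 2), sq_nonneg (‖z - 1‖)]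
  have hP := norm_le_of_norm_le_on_circle_diff_one (P := fun z => Q z * ((1 + z) / 2) ^ N)
    (C := C) (ε := ε / 4) (by positivity) (hQ.mul (by fun_prop))
    (fun z hz h1 => (hc z hz h1).mul (by fun_prop)) ?_ ?_
  · have hcont : Continuous (fun z : ℂ => ‖((1 + z) / 2) ^ N‖) := by fun_prop
    have h12 : ∀ᶠ z : ℂ in 𝓝[ball 0 1] 1, 1 / 2 < ‖((1 + z) / 2) ^ N‖ := by
      refine nhdsWithin_le_nhds (hcont.continuousAt.eventually_const_lt ?_)
      norm_num
    filter_upwards [self_mem_nhdsWithin, h12] with z hz h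
    have := hP z hz
    rw [norm_mul] at this
    rw [dist_zero_right]
    nlinarith [norm_nonneg (Q z)]
  · intro z hz h1
    rw [norm_mul, norm_pow]
    have := hC z hz h1
    have h2 := pow_le_one₀ (norm_nonneg _) (hpk z (by simpa using hz)) (n := N)
    calc ‖Q z‖ * ‖(1 + z) / 2‖ ^ N ≤ C * 1 := by gcongr
      _ = C := mul_one _
  · intro z hz h1
    have hz' : ‖z‖ = 1 := by simpa using hz
    rw [norm_mul, norm_pow]
    by_cases hzd : dist z 1 < δ
    · have h3 : ‖Q z‖ < ε / 4 := by simpa using hδb ⟨hzd, hz, h1⟩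
      have h2 := pow_le_one₀ (norm_nonneg _) (hpk z hz'.le) (n := N)
      calc ‖Q z‖ * ‖(1 + z) / 2‖ ^ N ≤ ε / 4 * 1 := by gcongr
        _ = ε / 4 := mul_one _
    · have h4 : ‖(1 + z) / 2‖ ≤ q := by
        refine Real.le_sqrt_of_sq_le ((norm_one_add_div_two_sq_le hz'.le).trans ?_)
        have : min δ 1 ≤ ‖z - 1‖ := by
          rw [← dist_eq_norm]; exact (min_le_left _ _).trans (not_lt.1 hzd)
        gcongr
      have h5 := hC z (by simp [hz']) h1
      calc ‖Q z‖ * ‖(1 + z) / 2‖ ^ N ≤ C * q ^ N := by gcongr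
        _ ≤ (C + 1) * (ε / 4 / (C + 1)) := by gcongr; linarith
        _ = ε / 4 := by field_simp

/-- If the boundary values of a Lipschitz function which is holomorphic in the disc are
differentiable at `1` along the circle, then its difference quotients at `1` converge from within
the disc. -/
theorem tendsto_slope_of_hasDerivAt_circle {G : ℂ → ℂ} {K : ℝ≥0} {c : ℂ} (hG : LipschitzWith K G)
    (hd : DifferentiableOn ℂ G (ball 0 1))
    (hc : HasDerivAt (fun θ : ℝ => G (Complex.exp (θ * Complex.I))) (c * Complex.I) 0) :
    Tendsto (fun z => (G z - G 1) / (z - 1) - c) (𝓝[ball 0 1] 1) (𝓝 0) := by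
  refine tendsto_zero_of_tendsto_zero_on_circle (C := K + ‖c‖) ?_ ?_ ?_ ?_
  · refine ((hd.sub_const _).div (by fun_prop) ?_).sub_const _
    rintro z hz h
    rw [sub_eq_zero] at h
    simp [h] at hz
  · intro z _ h1
    have := hG.continuous
    have h2 : z - 1 ≠ 0 := sub_ne_zero.2 h1
    fun_prop (disch := exact h2)
  · intro z _ h1
    refine (norm_sub_le _ _).trans (by
      gcongr
      rw [norm_div, div_le_iff₀ (norm_pos_iff.2 (sub_ne_zero.2 h1)), ← dist_eq_norm, ← dist_eq_norm]
      exact hG.dist_le_mul _ _)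
  · have he : HasDerivAt (fun θ : ℝ => Complex.exp (θ * Complex.I)) Complex.I 0 := by
      have h0 : HasDerivAt (fun θ : ℝ => (θ : ℂ) * Complex.I) Complex.I 0 := by
        simpa using (Complex.ofRealCLM.hasDerivAt (x := (0 : ℝ))).mul_const Complex.I
      simpa using h0.cexp
    have h1 := hasDerivAt_iff_tendsto_slope.1 hc
    have h2 := hasDerivAt_iff_tendsto_slope.1 he
    have h3 := ((h1.div h2 Complex.I_ne_zero).sub_const c)
    rw [mul_div_cancel_right₀ _ Complex.I_ne_zero, sub_self] at h3
    -- The quotient of the slopes of `G(e^{iθ})` and `e^{iθ}` at `θ = 0` is the slope of `G` itself;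
    -- substituting `θ = arg z` moves its limit to the circle.
    have harg : Tendsto Complex.arg (𝓝[sphere 0 1 \ {1}] 1) (𝓝[≠] 0) := by
      refine tendsto_nhdsWithin_iff.2 ⟨?_, ?_⟩
      · have : ContinuousAt Complex.arg 1 := Complex.continuousAt_arg (by simp)
        simpa [ContinuousAt] using this.tendsto.mono_left nhdsWithin_le_nhds
      · filter_upwards [self_mem_nhdsWithin] with z hz
        intro h
        have h1 : ‖z‖ = 1 := by simpa using hz.1
        have := Complex.norm_mul_exp_arg_mul_I z
        simp only [mem_singleton_iff] at h
        rw [h, h1] at this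
        simp at this
        exact hz.2 this.symm
    refine (h3.comp harg).congr' ?_
    filter_upwards [self_mem_nhdsWithin] with z hz
    have hz1 : ‖z‖ = 1 := by simpa using hz.1
    have h5 := Complex.norm_mul_exp_arg_mul_I z
    rw [hz1, Complex.ofReal_one, one_mul] at h5
    have hz2 : z - 1 ≠ 0 := sub_ne_zero.2 hz.2
    have h4 : (z.arg : ℂ) ≠ 0 := by
      intro h
      rw [h] at h5
      simp at h5
      exact hz.2 h5.symm
    simp only [Function.comp, Pi.div_apply, slope_def_module, sub_zero, h5, Complex.ofReal_zero,
      zero_mul, Complex.exp_zero, Complex.real_smul, Complex.ofReal_inv]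
    field_simp

/-- The derivative of a holomorphic function whose difference quotients at `1` converge in the disc
converges in every Stolz angle at `1`. -/
theorem tendsto_deriv_stolzSet {G : ℂ → ℂ} {c : ℂ} (hd : DifferentiableOn ℂ G (ball 0 1))
    (h : Tendsto (fun z => (G z - G 1) / (z - 1) - c) (𝓝[ball 0 1] 1) (𝓝 0)) (M : ℝ) :
    Tendsto (deriv G) (𝓝[Complex.stolzSet M] 1) (𝓝 c) := by
  rcases le_or_gt M 1 with hM | hM
  · simp [Complex.stolzSet_empty hM]
  rw [Metric.tendsto_nhds]
  intro ε hε
  -- Cauchy's estimate is applied on the circle of radius `ρ = (1 - ‖z‖) / 2` about `z`, where the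
  -- error of the linear approximation is at most `η (‖z - 1‖ + ρ)`. In the Stolz angle `‖z - 1‖ < 2
  -- M ρ`, so after division by `ρ` the bound is `η (2 M + 1) = ε / 2`.
  set η : ℝ := ε / (2 * (2 * M + 1)) with hη
  have hη0 : 0 < η := by positivity
  obtain ⟨δ, hδ, hδb⟩ := Metric.mem_nhdsWithin_iff.1 (Metric.tendsto_nhds.1 h η hη0)
  filter_upwards [self_mem_nhdsWithin,
    nhdsWithin_le_nhds (Metric.ball_mem_nhds (1 : ℂ) (half_pos hδ))] with z hz hzδ
  obtain ⟨hz1, hzM⟩ := hz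
  set ρ : ℝ := (1 - ‖z‖) / 2 with hρ
  have hρ0 : 0 < ρ := by simp only [hρ]; linarith
  have hρz : ρ ≤ ‖z - 1‖ := by
    have := norm_sub_norm_le (1 : ℂ) z
    rw [norm_one, norm_sub_rev] at this
    have := norm_nonneg (z - 1)
    simp only [hρ]; linarith
  rw [mem_ball, dist_eq_norm] at hzδ
  rw [norm_sub_rev] at hzM
  have hsub : closedBall z ρ ⊆ ball 0 1 := by
    intro w hw
    rw [mem_closedBall, dist_eq_norm] at hw
    have := norm_sub_norm_le w z
    simp only [mem_ball, dist_zero_right, hρ] at *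
    linarith
  have hdiff : DifferentiableOn ℂ (fun w => G w - G 1 - c * (w - 1)) (ball 0 1) :=
    (hd.sub_const _).sub (by fun_prop)
  have hest := Complex.norm_deriv_le_of_forall_mem_sphere_norm_le hρ0
    (f := fun w => G w - G 1 - c * (w - 1)) (C := η * (‖z - 1‖ + ρ))
    ((hdiff.mono hsub).diffContOnCl_ball (subset_refl _)) ?_
  · have hGz : HasDerivAt G (deriv G z) z :=
      (hd.differentiableAt (isOpen_ball.mem_nhds (by simpa using hz1))).hasDerivAt
    have hder : deriv (fun w => G w - G 1 - c * (w - 1)) z = deriv G z - c := by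
      have : HasDerivAt (fun w => G w - G 1 - c * (w - 1)) (deriv G z - c * 1) z :=
        (hGz.sub_const (G 1)).sub ((((hasDerivAt_id z).sub_const 1)).const_mul c)
      rw [this.deriv, mul_one]
    rw [hder] at hest
    rw [dist_eq_norm]
    calc ‖deriv G z - c‖ ≤ η * (‖z - 1‖ + ρ) / ρ := hest
      _ ≤ η * (M * (2 * ρ) + ρ) / ρ := by
          gcongr
          simp only [hρ]; linarith
      _ = ε / 2 := by simp only [hη]; field_simp
      _ < ε := by linarith
  · intro w hw
    rw [mem_sphere, dist_eq_norm] at hw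
    have hwb : w ∈ ball (0 : ℂ) 1 := hsub (by simp [dist_eq_norm, hw])
    have hw1 : w - 1 ≠ 0 := by
      intro h; rw [sub_eq_zero] at h; simp [h] at hwb
    have hnorm : ‖w - 1‖ ≤ ‖z - 1‖ + ρ := by
      rw [← hw, show w - 1 = (z - 1) + (w - z) by ring]; exact norm_add_le _ _
    have hwδ : dist w 1 < δ := by rw [dist_eq_norm]; linarith
    have h6 : dist ((G w - G 1) / (w - 1) - c) 0 < η := hδb ⟨hwδ, hwb⟩
    rw [dist_zero_right] at h6
    have h7 : G w - G 1 - c * (w - 1) = ((G w - G 1) / (w - 1) - c) * (w - 1) := by field_simp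
    rw [h7, norm_mul]
    gcongr

theorem continuous_circle_coe : Continuous (fun t : Circle => (t : ℂ)) := continuous_induced_dom

theorem ae_circleMeasure_of_ae_arg {p : ℝ → Prop} (hm : MeasurableSet {θ | p θ})
    (h : ∀ᵐ θ : ℝ, p θ) : ∀ᵐ t : Circle ∂circleMeasure, p (Complex.arg (t : ℂ)) := by
  have harg : Measurable (fun t : Circle => Complex.arg t) :=
    Complex.measurable_arg.comp continuous_circle_coe.measurable
  refine Measure.ae_smul_measure ?_ _
  refine (ae_map_iff Circle.exp.continuous.aemeasurable (harg hm)).2 ?_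
  refine (ae_restrict_iff' measurableSet_Ioc).2 ?_
  filter_upwards [h] with θ hθ hmem
  rwa [Circle.arg_exp hmem.1 hmem.2]

/-- **Fatou's theorem**: a bounded holomorphic function in the disc has non-tangential limits
almost everywhere on the circle. -/
theorem MemHInfty.ae_hasNontangentialLimit {f : ℂ → ℂ} (hf : MemHInfty f) :
    ∀ᵐ t ∂circleMeasure, HasNontangentialLimit f t (boundary f t) := by
  suffices h : ∀ᵐ t ∂circleMeasure, ∃ w, HasNontangentialLimit f t w by
    filter_upwards [h] with t ht
    rw [boundary, dif_pos ht]
    exact ht.choose_spec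
  obtain ⟨C, hC⟩ := hf.bounded
  obtain ⟨F, hF⟩ := hf.differentiableOn.isExactOn_ball
  have hLip : LipschitzOnWith C.toNNReal F (ball 0 1) := by
    refine (convex_ball (0 : ℂ) 1).lipschitzOnWith_of_nnnorm_hasDerivWithin_le (f' := f)
      (fun z hz => (hF z hz).hasDerivWithinAt) fun z hz => ?_
    rw [← NNReal.coe_le_coe, coe_nnnorm]
    exact (hC z hz).trans (Real.le_coe_toNNReal C)
  -- The extension gives the primitive values on the circle and continuity in full neighbourhoods of
  -- its points. The worse Lipschitz constant is harmless.
  obtain ⟨G, hG, hGF⟩ := hLip.extend_finite_dimension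
  set K := lipschitzExtensionConstant ℂ * C.toNNReal
  have hGd : ∀ z ∈ ball (0 : ℂ) 1, HasDerivAt G (f z) z := fun z hz =>
    (hF z hz).congr_of_eventuallyEq (by
      filter_upwards [isOpen_ball.mem_nhds hz] with w hw using (hGF hw).symm)
  have hexp : LipschitzWith 1 (fun θ : ℝ => Complex.exp (θ * Complex.I)) := by
    refine lipschitzWith_of_nnnorm_deriv_le (fun θ => by fun_prop) fun θ => ?_
    have h0 : HasDerivAt (fun θ : ℝ => (θ : ℂ) * Complex.I) Complex.I θ := by
      simpa using (Complex.ofRealCLM.hasDerivAt (x := θ)).mul_const Complex.I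
    rw [h0.cexp.deriv, ← NNReal.coe_le_coe]
    simp
  have hae := ((hG.comp hexp)).ae_differentiableAt_real
  refine (ae_circleMeasure_of_ae_arg (measurableSet_of_differentiableAt ℝ _) hae).mono ?_
  intro t ht
  set θ₀ := Complex.arg (t : ℂ) with hθ₀
  have htexp : Complex.exp (θ₀ * Complex.I) = t := by
    have := Complex.norm_mul_exp_arg_mul_I (t : ℂ)
    rwa [Circle.norm_coe, Complex.ofReal_one, one_mul] at this
  have ht0 : (t : ℂ) ≠ 0 := Circle.coe_ne_zero t
  obtain ⟨d, hd⟩ : ∃ d, HasDerivAt (fun θ : ℝ => G (Complex.exp (θ * Complex.I))) d θ₀ :=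
    ⟨_, ht.hasDerivAt⟩
  set c := d / Complex.I with hcdef
  have hball : ∀ z ∈ ball (0 : ℂ) 1, (t : ℂ) * z ∈ ball (0 : ℂ) 1 := by simp [Circle.norm_coe]
  have hGtd : ∀ z ∈ ball (0 : ℂ) 1, HasDerivAt (fun z => G (t * z)) (f (t * z) * t) z := by
    intro z hz
    have h1 : HasDerivAt (fun z : ℂ => (t : ℂ) * z) (t : ℂ) z := by
      simpa using (hasDerivAt_id z).const_mul (t : ℂ)
    exact (hGd _ (hball z hz)).comp z h1
  have hGt : LipschitzWith K (fun z => G (t * z)) := by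
    have : LipschitzWith 1 (fun z : ℂ => (t : ℂ) * z) := LipschitzWith.of_dist_le_mul fun x y => by
      rw [dist_eq_norm, dist_eq_norm, ← mul_sub, norm_mul]; simp [Circle.norm_coe]
    simpa [Function.comp_def] using hG.comp this
  have hdiff : DifferentiableOn ℂ (fun z => G (t * z)) (ball 0 1) := fun z hz =>
    (hGtd z hz).differentiableAt.differentiableWithinAt
  have hcirc : HasDerivAt (fun θ : ℝ => G (t * Complex.exp (θ * Complex.I))) (c * Complex.I) 0 := by
    rw [hcdef, div_mul_cancel₀ _ Complex.I_ne_zero]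
    have h1 : HasDerivAt (fun θ : ℝ => θ₀ + θ) 1 0 := by
      simpa using (hasDerivAt_id (0 : ℝ)).const_add θ₀
    have h2 : HasDerivAt (fun θ : ℝ => G (Complex.exp (θ * Complex.I))) d (θ₀ + 0) := by
      simpa using hd
    have h3 := h2.scomp 0 h1
    rw [one_smul] at h3
    refine h3.congr_of_eventuallyEq (Eventually.of_forall fun θ => ?_)
    beta_reduce
    rw [← htexp, ← Complex.exp_add, ← add_mul, Function.comp_apply, Complex.ofReal_add]
  -- The derivative of `z ↦ G (t z)` is `t f(t z)`, whence the division by `t`.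
  refine ⟨c / t, fun M => ?_⟩
  have hlim := tendsto_deriv_stolzSet hdiff (tendsto_slope_of_hasDerivAt_circle hGt hdiff hcirc) M
  refine (hlim.div_const (t : ℂ)).congr' ?_
  filter_upwards [self_mem_nhdsWithin] with z hz
  rw [(hGtd z (by simpa using hz.1)).deriv, mul_div_cancel_right₀ _ ht0]

/-! ### Integration on the circle, radial boundary values and Cauchy's formula -/

theorem ofReal_two_pi_ne_zero : ENNReal.ofReal (2 * Real.pi) ≠ 0 := by
  simp [Real.pi_pos]

instance : IsProbabilityMeasure circleMeasure := ⟨by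
  rw [circleMeasure, Measure.smul_apply,
    Measure.map_apply Circle.exp.continuous.measurable MeasurableSet.univ, preimage_univ,
    Measure.restrict_apply_univ, Real.volume_Ioc, smul_eq_mul,
    show Real.pi - -Real.pi = 2 * Real.pi by ring]
  exact ENNReal.inv_mul_cancel ofReal_two_pi_ne_zero ENNReal.ofReal_ne_top⟩

theorem integral_circleMeasure {F : Circle → ℂ} (hF : AEStronglyMeasurable F circleMeasure) :
    ∫ t, F t ∂circleMeasure =
      ((1 / (2 * Real.pi) : ℝ) : ℂ) * ∫ y in (-Real.pi)..Real.pi, F (Circle.exp y) := by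
  have hF' := hF.mono_ac (Measure.absolutelyContinuous_smul
    (ENNReal.inv_ne_zero.2 (ENNReal.ofReal_ne_top (r := 2 * Real.pi))))
  rw [circleMeasure, integral_smul_measure,
    integral_map Circle.exp.continuous.aemeasurable hF',
    intervalIntegral.integral_of_le (by linarith [Real.pi_pos]), ENNReal.toReal_inv,
    ENNReal.toReal_ofReal (by positivity), one_div, Complex.real_smul]

theorem integral_circle_of_differentiableOn {u : ℂ → ℂ} (hu : DifferentiableOn ℂ u (ball 0 1))
    {r : ℝ} (h0 : 0 ≤ r) (h1 : r < 1) :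
    ∫ t : Circle, u (r * t) ∂circleMeasure = u 0 := by
  have hmem : ∀ t : Circle, (r : ℂ) * t ∈ ball (0 : ℂ) 1 := fun t => by
    simp [Circle.norm_coe, abs_of_nonneg h0, h1]
  have hc : Continuous fun t : Circle => u (r * t) :=
    hu.continuousOn.comp_continuous (continuous_const.mul continuous_circle_coe) hmem
  have hd : DiffContOnCl ℂ u (ball 0 |r|) := by
    refine (hu.mono ?_).diffContOnCl_ball (subset_refl _)
    rw [abs_of_nonneg h0]
    exact closedBall_subset_ball h1
  rw [integral_circleMeasure hc.aestronglyMeasurable, ← hd.circleAverage, Real.circleAverage_def]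
  have hper : Function.Periodic (fun y : ℝ => u (r * Circle.exp y)) (2 * Real.pi) := fun y => by
    simp only [Circle.exp_add_two_pi]
  have := hper.intervalIntegral_add_eq 0 (-Real.pi)
  rw [zero_add, show -Real.pi + 2 * Real.pi = Real.pi by ring] at this
  rw [← this, Complex.real_smul, one_div]
  simp [circleMap]

theorem circle_sub_ne_zero (t : Circle) {w : ℂ} (hw : ‖w‖ < 1) : (t : ℂ) - w ≠ 0 := by
  intro h
  rw [sub_eq_zero] at h
  rw [← h, Circle.norm_coe] at hw
  exact lt_irrefl _ hw

/-- `u` is a bounded holomorphic function in the disc with radial boundary values `U` almost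
everywhere on the circle. -/
structure HasBoundary (u : ℂ → ℂ) (U : Circle → ℂ) : Prop where
  memHInfty : MemHInfty u
  tendsto : ∀ᵐ t : Circle ∂circleMeasure, Tendsto (fun r : ℝ => u (r * t)) (𝓝[<] 1) (𝓝 (U t))

namespace HasBoundary

variable {u v : ℂ → ℂ} {U V : Circle → ℂ}

theorem congr (h : HasBoundary u U) (huv : EqOn u v (ball 0 1)) : HasBoundary v U := by
  refine ⟨⟨h.1.1.congr fun z hz => (huv hz).symm, ?_⟩, ?_⟩
  · obtain ⟨C, hC⟩ := h.1.2
    exact ⟨C, fun z hz => by rw [← huv hz]; exact hC z hz⟩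
  · filter_upwards [h.2] with t ht
    refine ht.congr' ?_
    filter_upwards [Ioo_mem_nhdsLT (show (0 : ℝ) < 1 by norm_num)] with r hr
    exact huv (by simp [Circle.norm_coe, abs_of_pos hr.1, hr.2])

theorem add (hu : HasBoundary u U) (hv : HasBoundary v V) :
    HasBoundary (fun z => u z + v z) (fun t => U t + V t) := by
  refine ⟨⟨hu.1.1.add hv.1.1, ?_⟩, ?_⟩
  · obtain ⟨C, hC⟩ := hu.1.2
    obtain ⟨D, hD⟩ := hv.1.2
    exact ⟨C + D, fun z hz => (norm_add_le _ _).trans (add_le_add (hC z hz) (hD z hz))⟩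
  · filter_upwards [hu.2, hv.2] with t h1 h2 using h1.add h2

theorem mul (hu : HasBoundary u U) (hv : HasBoundary v V) :
    HasBoundary (fun z => u z * v z) (fun t => U t * V t) := by
  refine ⟨⟨hu.1.1.mul hv.1.1, ?_⟩, ?_⟩
  · obtain ⟨C, hC⟩ := hu.1.2
    obtain ⟨D, hD⟩ := hv.1.2
    refine ⟨C * D, fun z hz => ?_⟩
    rw [norm_mul]
    exact mul_le_mul (hC z hz) (hD z hz) (norm_nonneg _) ((norm_nonneg _).trans (hC z hz))
  · filter_upwards [hu.2, hv.2] with t h1 h2 using h1.mul h2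

theorem of_differentiableAt (h : ∀ z ∈ closedBall (0 : ℂ) 1, DifferentiableAt ℂ u z) :
    HasBoundary u (fun t => u t) := by
  refine ⟨⟨fun z hz => (h z (ball_subset_closedBall hz)).differentiableWithinAt, ?_⟩,
    Eventually.of_forall fun t => ?_⟩
  · have hc : ContinuousOn u (closedBall 0 1) := fun z hz => (h z hz).continuousAt.continuousWithinAt
    obtain ⟨C, hC⟩ := (isCompact_closedBall (0 : ℂ) 1).exists_bound_of_continuousOn hc
    exact ⟨C, fun z hz => hC z (ball_subset_closedBall hz)⟩
  · have h1 : ContinuousAt u t := (h t (by simp [Circle.norm_coe])).continuousAt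
    have h2 : Tendsto (fun r : ℝ => (r : ℂ) * t) (𝓝[<] 1) (𝓝 (t : ℂ)) := by
      have : Continuous (fun r : ℝ => (r : ℂ) * t) := by fun_prop
      simpa using (this.tendsto 1).mono_left nhdsWithin_le_nhds
    exact h1.tendsto.comp h2

theorem const (c : ℂ) : HasBoundary (fun _ => c) (fun _ => c) :=
  of_differentiableAt fun _ _ => differentiableAt_const c

theorem id : HasBoundary (fun z => z) (fun t => t) :=
  of_differentiableAt fun _ _ => differentiableAt_id

theorem const_mul (c : ℂ) (hu : HasBoundary u U) :
    HasBoundary (fun z => c * u z) (fun t => c * U t) := (const c).mul hu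

theorem sub (hu : HasBoundary u U) (hv : HasBoundary v V) :
    HasBoundary (fun z => u z - v z) (fun t => U t - V t) := by
  simpa [sub_eq_add_neg] using hu.add (hv.const_mul (-1))

theorem ae_norm_le (h : HasBoundary u U) : ∃ C : ℝ, ∀ᵐ t : Circle ∂circleMeasure, ‖U t‖ ≤ C := by
  obtain ⟨C, hC⟩ := h.1.2
  refine ⟨C, ?_⟩
  filter_upwards [h.2] with t ht
  refine le_of_tendsto ht.norm ?_
  filter_upwards [Ioo_mem_nhdsLT (show (0 : ℝ) < 1 by norm_num)] with r hr
  exact hC _ (by simp [Circle.norm_coe, abs_of_pos hr.1, hr.2])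

/-- Both claims follow from approximating `U` by the dilates `u (r_n t)` with `r_n ↑ 1`: the mean
value property holds for each dilate, and boundedness of `u` allows dominated convergence. -/
theorem aestronglyMeasurable_and_integral (h : HasBoundary u U) :
    AEStronglyMeasurable U circleMeasure ∧ ∫ t, U t ∂circleMeasure = u 0 := by
  obtain ⟨r, -, hr, hlim⟩ := exists_seq_strictMono_tendsto' (show (0 : ℝ) < 1 by norm_num)
  have hlim' : Tendsto r atTop (𝓝[<] 1) :=
    tendsto_nhdsWithin_iff.2 ⟨hlim, Eventually.of_forall fun n => (hr n).2⟩
  have hmem : ∀ n (t : Circle), (r n : ℂ) * t ∈ ball (0 : ℂ) 1 := fun n t => by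
    simp [Circle.norm_coe, abs_of_pos (hr n).1, (hr n).2]
  have hmeas : ∀ n, AEStronglyMeasurable (fun t : Circle => u (r n * t)) circleMeasure := fun n =>
    (h.1.1.continuousOn.comp_continuous (continuous_const.mul continuous_circle_coe)
      (hmem n)).aestronglyMeasurable
  have hae : ∀ᵐ t : Circle ∂circleMeasure, Tendsto (fun n => u (r n * t)) atTop (𝓝 (U t)) := by
    filter_upwards [h.2] with t ht using ht.comp hlim'
  refine ⟨aestronglyMeasurable_of_tendsto_ae _ hmeas hae, ?_⟩
  obtain ⟨C, hC⟩ := h.1.2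
  have := tendsto_integral_of_dominated_convergence (fun _ => C) hmeas (integrable_const C)
    (fun n => Eventually.of_forall fun t => hC _ (hmem n t)) hae
  refine tendsto_nhds_unique this ?_
  simp_rw [integral_circle_of_differentiableOn h.1.1 (hr _).1.le (hr _).2]
  exact tendsto_const_nhds

theorem aestronglyMeasurable (h : HasBoundary u U) : AEStronglyMeasurable U circleMeasure :=
  h.aestronglyMeasurable_and_integral.1

theorem integral_eq (h : HasBoundary u U) : ∫ t, U t ∂circleMeasure = u 0 :=
  h.aestronglyMeasurable_and_integral.2

theorem memLp_top (h : HasBoundary u U) : MemLp U ∞ circleMeasure := by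
  obtain ⟨C, hC⟩ := h.ae_norm_le
  exact memLp_top_of_bound h.aestronglyMeasurable C hC

theorem integrable (h : HasBoundary u U) : Integrable U circleMeasure :=
  memLp_one_iff_integrable.1 (h.memLp_top.mono_exponent le_top)

theorem integrable_mul_conj (hu : HasBoundary u U) (hv : HasBoundary v V) :
    Integrable (fun t => U t * conj (V t)) circleMeasure := by
  obtain ⟨C, hC⟩ := hv.ae_norm_le
  refine hu.integrable.mul_bdd (c := C)
    (Complex.continuous_conj.comp_aestronglyMeasurable hv.aestronglyMeasurable) ?_
  filter_upwards [hC] with t ht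
  simpa using ht

theorem dslope (hu : HasBoundary u U) {w : ℂ} (hw : ‖w‖ < 1) :
    HasBoundary (dslope u w) (fun t => (U t - u w) / (t - w)) := by
  have hd : DifferentiableOn ℂ (_root_.dslope u w) (ball 0 1) :=
    (Complex.differentiableOn_dslope (isOpen_ball.mem_nhds (by simpa using hw))).2 hu.1.1
  refine ⟨⟨hd, ?_⟩, ?_⟩
  · obtain ⟨C, hC⟩ := hu.1.2
    obtain ⟨ρ, h1, h2⟩ := exists_between hw
    obtain ⟨D, hD⟩ := (isCompact_closedBall (0 : ℂ) ρ).exists_bound_of_continuousOn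
      (hd.continuousOn.mono (closedBall_subset_ball h2))
    -- Compactness bounds the slope for `‖z‖ ≤ ρ`; outside, the denominator is at least `ρ - ‖w‖`.
    refine ⟨max D (2 * C / (ρ - ‖w‖)), fun z hz => ?_⟩
    by_cases hzρ : z ∈ closedBall (0 : ℂ) ρ
    · exact (hD z hzρ).trans (le_max_left _ _)
    · refine le_trans ?_ (le_max_right _ _)
      have hzρ' : ρ < ‖z‖ := by simpa using hzρ
      have hne : z ≠ w := by rintro rfl; linarith
      have hzw : ρ - ‖w‖ ≤ ‖z - w‖ := by linarith [norm_sub_norm_le z w]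
      rw [dslope_of_ne _ hne, slope_def_field, norm_div]
      have h3 := norm_sub_le (u z) (u w)
      have h4 := hC z hz
      have h5 := hC w (by simpa using hw)
      have : ‖u z - u w‖ ≤ 2 * C := by linarith
      have : 0 ≤ 2 * C := (norm_nonneg _).trans this
      have h6 : 0 < ρ - ‖w‖ := by linarith
      gcongr
  · filter_upwards [hu.2] with t ht
    have htw := circle_sub_ne_zero t hw
    have h2 : Tendsto (fun r : ℝ => (r : ℂ) * t - w) (𝓝[<] 1) (𝓝 ((t : ℂ) - w)) := by
      have : Continuous (fun r : ℝ => (r : ℂ) * t - w) := by fun_prop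
      simpa using (this.tendsto 1).mono_left nhdsWithin_le_nhds
    refine ((ht.sub_const (u w)).div h2 htw).congr' ?_
    filter_upwards [h2.eventually_ne htw] with r hr
    rw [dslope_of_ne _ (sub_ne_zero.1 hr), slope_def_field]
    rfl

end HasBoundary

theorem one_sub_mul_conj_ne_zero {z w : ℂ} (hz : ‖z‖ ≤ 1) (hw : ‖w‖ < 1) : 1 - z * conj w ≠ 0 := by
  intro h
  have : ‖z * conj w‖ = 1 := by rw [← sub_eq_zero.1 h, norm_one]
  rw [norm_mul, RCLike.norm_conj] at this
  nlinarith [norm_nonneg z, norm_nonneg w]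

theorem circle_mul_conj (t : Circle) : (t : ℂ) * conj (t : ℂ) = 1 := by
  rw [Complex.mul_conj, Circle.normSq_coe, Complex.ofReal_one]

theorem one_sub_conj_circle_mul_ne_zero (t : Circle) {w : ℂ} (hw : ‖w‖ < 1) :
    1 - conj (t : ℂ) * w ≠ 0 := by
  have := one_sub_mul_conj_ne_zero (z := conj (t : ℂ)) (w := conj w)
    (by simp [Circle.norm_coe]) (by simpa using hw)
  simpa using this

theorem conj_circle_mul (t : Circle) {w : ℂ} (hw : ‖w‖ < 1) :
    1 / (1 - conj (t : ℂ) * w) = t / (t - w) := by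
  have h1 := one_sub_conj_circle_mul_ne_zero t hw
  have h2 := circle_sub_ne_zero t hw
  rw [div_eq_div_iff h1 h2]
  linear_combination w * circle_mul_conj t

theorem hasBoundary_inv_one_sub {w : ℂ} (hw : ‖w‖ < 1) :
    HasBoundary (fun z => 1 / (1 - z * conj w)) (fun t => 1 / (1 - t * conj w)) :=
  HasBoundary.of_differentiableAt fun z hz => by
    have := one_sub_mul_conj_ne_zero (z := z) (by simpa using hz) hw
    fun_prop (disch := exact this)

/-- **Cauchy's formula** for bounded holomorphic functions, with the Szegő kernel. -/
theorem HasBoundary.integral_cauchy {u : ℂ → ℂ} {U : Circle → ℂ} (hu : HasBoundary u U) {w : ℂ}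
    (hw : ‖w‖ < 1) : ∫ t : Circle, U t * conj (1 / (1 - t * conj w)) ∂circleMeasure = u w := by
  have hone : ∫ t : Circle, conj (1 / (1 - t * conj w)) ∂circleMeasure = 1 := by
    rw [integral_conj, (hasBoundary_inv_one_sub hw).integral_eq]
    simp
  have hker : ∀ t : Circle, conj (1 / (1 - t * conj w)) = t / (t - w) := fun t => by
    rw [← conj_circle_mul t hw]; simp
  have hb := HasBoundary.id.mul (hu.dslope hw)
  have h1 := hb.integral_eq
  rw [zero_mul] at h1
  -- On the circle the conjugate Szegő kernel is `t / (t - w)`. The first summand is thus the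
  -- boundary function of `z` times a divided difference of `u`; it vanishes at `0`, hence has
  -- integral zero.
  have hsplit : ∀ t : Circle, U t * conj (1 / (1 - t * conj w)) =
      t * ((U t - u w) / (t - w)) + u w * conj (1 / (1 - t * conj w)) := fun t => by
    rw [hker]; ring
  simp_rw [hsplit]
  rw [integral_add hb.integrable, h1, integral_const_mul, hone, zero_add, mul_one]
  refine Integrable.const_mul ?_ _
  simpa using (HasBoundary.const 1).integrable_mul_conj (hasBoundary_inv_one_sub hw)

theorem MemHInfty.hasBoundary {f : ℂ → ℂ} (hf : MemHInfty f) : HasBoundary f (boundary f) := by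
  refine ⟨hf, ?_⟩
  filter_upwards [hf.ae_hasNontangentialLimit] with t ht
  have h1 : Tendsto (fun r : ℝ => (r : ℂ)) (𝓝[<] 1) (𝓝[Complex.stolzSet 2] 1) := by
    refine tendsto_nhdsWithin_iff.2 ⟨?_, ?_⟩
    · simpa using (Complex.continuous_ofReal.tendsto 1).mono_left nhdsWithin_le_nhds
    · filter_upwards [Ioo_mem_nhdsLT (show (0 : ℝ) < 1 by norm_num)] with r hr
      have h2 : ‖(1 : ℂ) - r‖ = 1 - r := by
        rw [← Complex.ofReal_one, ← Complex.ofReal_sub, Complex.norm_real, Real.norm_eq_abs,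
          abs_of_pos (by linarith [hr.2])]
      have h3 : ‖(r : ℂ)‖ = r := by simp [abs_of_pos hr.1]
      refine ⟨by rw [h3]; exact hr.2, ?_⟩
      rw [h2, h3]
      linarith [hr.2]
  simpa [Function.comp_def, mul_comm] using (ht 2).comp h1

theorem HasBoundary.ae_eq {u : ℂ → ℂ} {U V : Circle → ℂ} (hU : HasBoundary u U)
    (hV : HasBoundary u V) : U =ᵐ[circleMeasure] V := by
  filter_upwards [hU.2, hV.2] with t h1 h2 using tendsto_nhds_unique h1 h2

theorem HasBoundary.sum {ι : Type*} (s : Finset ι) {u : ι → ℂ → ℂ} {U : ι → Circle → ℂ}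
    (h : ∀ i ∈ s, HasBoundary (u i) (U i)) :
    HasBoundary (fun z => ∑ i ∈ s, u i z) (fun t => ∑ i ∈ s, U i t) := by
  classical
  induction s using Finset.induction_on with
  | empty => simpa using HasBoundary.const 0
  | insert i s hi ih =>
    simp only [Finset.sum_insert hi]
    exact (h i (by simp)).add (ih fun j hj => h j (by simp [hj]))

theorem HasBoundary.of_analyticAt {u : ℂ → ℂ} (h : ∀ z : ℂ, ‖z‖ ≤ 1 → AnalyticAt ℂ u z) :
    HasBoundary u (fun t => u t) :=
  HasBoundary.of_differentiableAt fun z hz => (h z (by simpa using hz)).differentiableAt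

/-! ### Blaschke products and orthonormality of the Takenaka–Malmquist system -/

variable {a : ℕ → ℂ}

@[simp] theorem blaschke_zero (z : ℂ) : blaschke a 0 z = 1 := by simp [blaschke]

theorem blaschke_succ (n : ℕ) (z : ℂ) :
    blaschke a (n + 1) z = blaschke a n z * ((z - a n) / (1 - z * conj (a n))) := by
  rw [blaschke, Finset.prod_range_succ, blaschke]

theorem blaschke_add (k m : ℕ) (z : ℂ) :
    blaschke a (k + m) z = blaschke a k z * blaschke (fun i => a (k + i)) m z := by
  rw [blaschke, Finset.prod_range_add, blaschke, blaschke]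

theorem blaschke_eq_zero {n j : ℕ} (hj : j < n) : blaschke a n (a j) = 0 :=
  Finset.prod_eq_zero (Finset.mem_range.2 hj) (by simp)

theorem blaschke_eq_mul_shift {k n : ℕ} (hk : k ≤ n) (z : ℂ) :
    blaschke a n z = blaschke a k z * blaschke (fun i => a (k + i)) (n - k) z := by
  rw [← blaschke_add, Nat.add_sub_cancel' hk]

theorem blaschke_shift_eq_zero {k n : ℕ} (hk : k < n) :
    blaschke (fun i => a (k + i)) (n - k) (a k) = 0 :=
  blaschke_eq_zero (a := fun i => a (k + i)) (j := 0) (Nat.sub_pos_of_lt hk)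

theorem partialSum_succ (n : ℕ) (g : Circle → ℂ) (z : ℂ) :
    partialSum a (n + 1) g z = partialSum a n g z + coeff a g n * phi a n z := by
  simp [partialSum, Finset.sum_range_succ]

theorem analyticAt_inv_one_sub {w z : ℂ} (hw : ‖w‖ < 1) (hz : ‖z‖ ≤ 1) (c : ℂ) :
    AnalyticAt ℂ (fun z => c / (1 - z * conj w)) z := by
  have := one_sub_mul_conj_ne_zero hz hw
  exact analyticAt_const.div (analyticAt_const.sub (analyticAt_id.mul analyticAt_const)) this

theorem sq_sqrt_one_sub (k : ℕ) (ha : ∀ k, ‖a k‖ < 1) :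
    ((Real.sqrt (1 - ‖a k‖ ^ 2) : ℝ) : ℂ) * ((Real.sqrt (1 - ‖a k‖ ^ 2) : ℝ) : ℂ) =
      1 - a k * conj (a k) := by
  have h : 0 ≤ 1 - ‖a k‖ ^ 2 := by nlinarith [ha k, norm_nonneg (a k)]
  rw [← Complex.ofReal_mul, Real.mul_self_sqrt h, Complex.mul_conj, Complex.normSq_eq_norm_sq]
  simp

section

variable (ha : ∀ k, ‖a k‖ < 1)

include ha

theorem analyticAt_blaschke (n : ℕ) {z : ℂ} (hz : ‖z‖ ≤ 1) : AnalyticAt ℂ (blaschke a n) z := by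
  have : blaschke a n = fun z => ∏ j ∈ Finset.range n, (z - a j) / (1 - z * conj (a j)) := rfl
  rw [this]
  refine Finset.analyticAt_fun_prod _ fun j _ => ?_
  exact (analyticAt_id.sub analyticAt_const).div
    (analyticAt_const.sub (analyticAt_id.mul analyticAt_const))
    (one_sub_mul_conj_ne_zero hz (ha j))

theorem analyticAt_phi (n : ℕ) {z : ℂ} (hz : ‖z‖ ≤ 1) : AnalyticAt ℂ (phi a n) z :=
  (analyticAt_inv_one_sub (ha n) hz _).mul (analyticAt_blaschke ha n hz)

theorem analyticAt_partialSum (n : ℕ) (g : Circle → ℂ) {z : ℂ} (hz : ‖z‖ ≤ 1) :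
    AnalyticAt ℂ (partialSum a n g) z := by
  have : partialSum a n g = fun z => ∑ k ∈ Finset.range n, coeff a g k * phi a k z := rfl
  rw [this]
  exact Finset.analyticAt_fun_sum _ fun k _ => analyticAt_const.mul (analyticAt_phi ha k hz)

theorem hasBoundary_blaschke (n : ℕ) : HasBoundary (blaschke a n) (fun t => blaschke a n t) :=
  .of_analyticAt fun _ hz => analyticAt_blaschke ha n hz

theorem hasBoundary_phi (n : ℕ) : HasBoundary (phi a n) (fun t => phi a n t) :=
  .of_analyticAt fun _ hz => analyticAt_phi ha n hz

theorem hasBoundary_partialSum (n : ℕ) (g : Circle → ℂ) :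
    HasBoundary (partialSum a n g) (fun t => partialSum a n g t) :=
  .of_analyticAt fun _ hz => analyticAt_partialSum ha n g hz

theorem blaschke_mul_conj (n : ℕ) (t : Circle) :
    blaschke a n t * conj (blaschke a n t) = 1 := by
  induction n with
  | zero => simp
  | succ n ih =>
    have h1 := one_sub_mul_conj_ne_zero (Circle.norm_coe t).le (ha n)
    have h2 := one_sub_conj_circle_mul_ne_zero t (ha n)
    have h3 : (t - a n) / (1 - t * conj (a n)) * conj ((t - a n) / (1 - t * conj (a n))) = 1 := by
      simp only [map_div₀, map_sub, map_mul, map_one, Complex.conj_conj]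
      rw [div_mul_div_comm, div_eq_one_iff_eq (mul_ne_zero h1 h2)]
      linear_combination (1 - a n * conj (a n)) * circle_mul_conj t
    rw [blaschke_succ, map_mul, mul_mul_mul_comm, ih, h3, one_mul]

theorem blaschke_circle_ne_zero (n : ℕ) (t : Circle) : blaschke a n t ≠ 0 :=
  left_ne_zero_of_mul_eq_one (blaschke_mul_conj ha n t)

theorem norm_blaschke_circle (n : ℕ) (t : Circle) : ‖blaschke a n t‖ = 1 := by
  have h := congrArg norm (blaschke_mul_conj ha n t)
  rw [norm_mul, RCLike.norm_conj, norm_one] at h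
  nlinarith [norm_nonneg (blaschke a n t)]

/-- Since `|B_k| = 1` on the circle, the Blaschke factors cancel, leaving Cauchy's formula at `a_k`.
Orthonormality, the coefficients of `f` and the remainder bound all rest on this. -/
theorem integral_blaschke_mul_conj_phi (k : ℕ) {v : ℂ → ℂ} {V : Circle → ℂ}
    (hv : HasBoundary v V) :
    ∫ t : Circle, blaschke a k t * V t * conj (phi a k t) ∂circleMeasure =
      ((Real.sqrt (1 - ‖a k‖ ^ 2) : ℝ) : ℂ) * v (a k) := by
  rw [← hv.integral_cauchy (ha k), ← integral_const_mul]
  refine integral_congr_ae (Eventually.of_forall fun t => ?_)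
  simp only [phi, map_mul, map_div₀, map_sub, map_one, Complex.conj_conj, Complex.conj_ofReal]
  linear_combination ((Real.sqrt (1 - ‖a k‖ ^ 2) : ℝ) : ℂ) * V t / (1 - conj (t : ℂ) * a k) *
    blaschke_mul_conj ha k t

theorem integral_phi_mul_conj_phi_self (k : ℕ) :
    ∫ t : Circle, phi a k t * conj (phi a k t) ∂circleMeasure = 1 := by
  have h := integral_blaschke_mul_conj_phi ha k
    ((hasBoundary_inv_one_sub (ha k)).const_mul ((Real.sqrt (1 - ‖a k‖ ^ 2) : ℝ) : ℂ))
  have h1 := one_sub_mul_conj_ne_zero (ha k).le (ha k)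
  rw [← mul_assoc, sq_sqrt_one_sub k ha, mul_one_div, div_self h1] at h
  rw [← h]
  congr 1 with t
  simp only [phi]
  ring

/-- The quotient `B_j / B_k` still contains the factor that vanishes at `a_k`. -/
theorem integral_phi_mul_conj_phi_of_lt {j k : ℕ} (hkj : k < j) :
    ∫ t : Circle, phi a j t * conj (phi a k t) ∂circleMeasure = 0 := by
  have h := integral_blaschke_mul_conj_phi ha k
    (((hasBoundary_inv_one_sub (ha j)).const_mul ((Real.sqrt (1 - ‖a j‖ ^ 2) : ℝ) : ℂ)).mul
      (hasBoundary_blaschke (fun i => ha (k + i)) (j - k)))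
  rw [blaschke_shift_eq_zero hkj, mul_zero, mul_zero] at h
  rw [← h]
  congr 1 with t
  simp only [phi]
  rw [blaschke_eq_mul_shift hkj.le]
  ring

theorem integral_phi_mul_conj_phi (j k : ℕ) :
    ∫ t : Circle, phi a j t * conj (phi a k t) ∂circleMeasure = if j = k then 1 else 0 := by
  split_ifs with h
  · subst h; exact integral_phi_mul_conj_phi_self ha j
  · rcases lt_or_gt_of_ne h with h | h
    · have h1 := integral_phi_mul_conj_phi_of_lt ha h
      rw [← map_eq_zero (starRingEnd ℂ), ← integral_conj] at h1
      rw [← h1]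
      congr 1 with t
      simp [mul_comm]
    · exact integral_phi_mul_conj_phi_of_lt ha h

theorem integral_sum_phi_mul_conj_phi (n : ℕ) (c : ℕ → ℂ) (k : ℕ) :
    ∫ t : Circle, (∑ j ∈ Finset.range n, c j * phi a j t) * conj (phi a k t) ∂circleMeasure =
      if k < n then c k else 0 := by
  simp_rw [Finset.sum_mul, mul_assoc]
  rw [integral_finsetSum _ fun j _ =>
    ((hasBoundary_phi ha j).integrable_mul_conj (hasBoundary_phi ha k)).const_mul _]
  simp_rw [integral_const_mul, integral_phi_mul_conj_phi ha]
  simp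

/-! ### The remainder of the partial sums -/

/-- A bounded holomorphic function is interpolated by its partial Takenaka--Malmquist sums at the
zeros of the Blaschke product: the remainder is the Blaschke product times a bounded holomorphic
function. -/
theorem HasBoundary.exists_eq_partialSum_add {f : ℂ → ℂ} {g : Circle → ℂ} (hf : HasBoundary f g)
    (n : ℕ) : ∃ h H, HasBoundary h H ∧
      (∀ z ∈ ball (0 : ℂ) 1, f z = partialSum a n g z + blaschke a n z * h z) ∧
      ∀ᵐ t : Circle ∂circleMeasure, g t = partialSum a n g t + blaschke a n t * H t := by
  suffices ∃ h H, HasBoundary h H ∧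
      ∀ z ∈ ball (0 : ℂ) 1, f z = partialSum a n g z + blaschke a n z * h z by
    obtain ⟨h, H, hH, heq⟩ := this
    refine ⟨h, H, hH, heq, ?_⟩
    exact (hf.congr heq).ae_eq
      ((hasBoundary_partialSum ha n g).add ((hasBoundary_blaschke ha n).mul hH))
  induction n with
  | zero => exact ⟨f, g, hf, by simp [partialSum]⟩
  | succ n ih =>
    obtain ⟨h, H, hH, heq⟩ := ih
    have hae := (hf.congr heq).ae_eq
      ((hasBoundary_partialSum ha n g).add ((hasBoundary_blaschke ha n).mul hH))
    have hcoeff : coeff a g n = ((Real.sqrt (1 - ‖a n‖ ^ 2) : ℝ) : ℂ) * h (a n) := by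
      have h0 : ∫ t : Circle, partialSum a n g t * conj (phi a n t) ∂circleMeasure = 0 := by
        have := integral_sum_phi_mul_conj_phi ha n (coeff a g) n
        rwa [if_neg (lt_irrefl n)] at this
      have h1 : coeff a g n = ∫ t : Circle, (partialSum a n g t * conj (phi a n t) +
          blaschke a n t * H t * conj (phi a n t)) ∂circleMeasure := by
        refine integral_congr_ae ?_
        filter_upwards [hae] with t ht
        rw [ht]; ring
      rw [h1, integral_add ((hasBoundary_partialSum ha n g).integrable_mul_conj
        (hasBoundary_phi ha n)) (((hasBoundary_blaschke ha n).mul hH).integrable_mul_conj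
        (hasBoundary_phi ha n)), h0, zero_add, integral_blaschke_mul_conj_phi ha n hH]
    -- The new remainder is the divided difference of `(1 - z conj (a n)) h` at `a n`. The value
    -- subtracted there, `(1 - |a_n|²) h(a_n)`, is the one produced by `coeff a g n * phi a n`.
    have hb : HasBoundary (fun z => (1 - z * conj (a n)) * h z)
        (fun t => (1 - t * conj (a n)) * H t) :=
      ((HasBoundary.const 1).sub (HasBoundary.id.mul (HasBoundary.const (conj (a n))))).mul hH
    refine ⟨_, _, hb.dslope (ha n), fun z hz => ?_⟩
    have hz' := one_sub_mul_conj_ne_zero (z := z) (by simpa using (mem_ball_zero_iff.1 hz).le) (ha n)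
    have hds := sub_smul_dslope (fun z => (1 - z * conj (a n)) * h z) (a n) z
    rw [smul_eq_mul] at hds
    rw [heq z hz, partialSum_succ, blaschke_succ, hcoeff, phi]
    have h2 := sq_sqrt_one_sub n ha
    generalize _root_.dslope (fun z => (1 - z * conj (a n)) * h z) (a n) z = D at hds ⊢
    field_simp
    linear_combination (-blaschke a n z) * hds - blaschke a n z * h (a n) * h2

/-- The bounded holomorphic factor of the remainder of a partial Takenaka--Malmquist sum is bounded
locally uniformly in the order of the sum. -/
theorem HasBoundary.norm_remainder_le {h : ℂ → ℂ} {g H : Circle → ℂ} {n : ℕ} {C : ℝ}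
    (hH : HasBoundary h H)
    (heq : ∀ᵐ t : Circle ∂circleMeasure, g t = partialSum a n g t + blaschke a n t * H t)
    (hC : ∀ᵐ t : Circle ∂circleMeasure, ‖g t‖ ≤ C) {w : ℂ} (hw : ‖w‖ < 1) :
    ‖h w‖ ≤ C / (1 - ‖w‖) := by
  have hker := hasBoundary_inv_one_sub hw
  -- The test function `B_n` times the Szegő kernel at `w` is orthogonal to every `φ_k` with `k <
  -- n`. Pairing `g` with it therefore isolates `h w`, and `|B_n| = 1` keeps the bound free of `n`.
  have hB := (hasBoundary_blaschke ha n).mul hker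
  have hzero : ∫ t : Circle, partialSum a n g t *
      conj (blaschke a n t * (1 / (1 - t * conj w))) ∂circleMeasure = 0 := by
    simp_rw [partialSum, Finset.sum_mul, mul_assoc]
    rw [integral_finsetSum _ fun k _ =>
      ((hasBoundary_phi ha k).integrable_mul_conj hB).const_mul _]
    refine Finset.sum_eq_zero fun k hk => ?_
    rw [integral_const_mul]
    have hk' := Finset.mem_range.1 hk
    have h1 := integral_blaschke_mul_conj_phi ha k
      ((hasBoundary_blaschke (fun i => ha (k + i)) (n - k)).mul hker)
    rw [blaschke_shift_eq_zero hk', zero_mul, mul_zero, ← map_eq_zero (starRingEnd ℂ),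
      ← integral_conj] at h1
    refine mul_eq_zero_of_right _ ?_
    rw [← h1]
    congr 1 with t
    rw [blaschke_eq_mul_shift hk'.le]
    simp only [map_mul, Complex.conj_conj]
    ring
  have hrep : h w = ∫ t : Circle, g t * conj (blaschke a n t * (1 / (1 - t * conj w)))
      ∂circleMeasure := by
    have h1 : ∫ t : Circle, g t * conj (blaschke a n t * (1 / (1 - t * conj w))) ∂circleMeasure =
        ∫ t : Circle, (partialSum a n g t * conj (blaschke a n t * (1 / (1 - t * conj w))) +
          H t * conj (1 / (1 - t * conj w))) ∂circleMeasure := by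
      refine integral_congr_ae ?_
      filter_upwards [heq] with t ht
      rw [ht, map_mul]
      linear_combination H t * conj (1 / (1 - (t : ℂ) * conj w)) * blaschke_mul_conj ha n t
    rw [h1, integral_add ((hasBoundary_partialSum ha n g).integrable_mul_conj hB)
      (hH.integrable_mul_conj hker), hzero, zero_add, hH.integral_cauchy hw]
  rw [hrep]
  have hw1 : 0 < 1 - ‖w‖ := by linarith
  have hbound : ∀ᵐ t : Circle ∂circleMeasure,
      ‖g t * conj (blaschke a n t * (1 / (1 - t * conj w)))‖ ≤ C / (1 - ‖w‖) := by
    filter_upwards [hC] with t ht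
    rw [norm_mul, RCLike.norm_conj, norm_mul, norm_blaschke_circle ha, one_mul, norm_div, norm_one,
      mul_one_div]
    have h2 : 1 - ‖w‖ ≤ ‖1 - (t : ℂ) * conj w‖ := by
      have := norm_sub_norm_le 1 ((t : ℂ) * conj w)
      rwa [norm_one, norm_mul, RCLike.norm_conj, Circle.norm_coe, one_mul] at this
    have h3 : 0 ≤ C := (norm_nonneg _).trans ht
    gcongr
  simpa using norm_integral_le_of_norm_le_const hbound

end

/-! ### Christoffel–Darboux formula and divided differences -/

/-- The reproducing kernel of the span of `φ_0, …, φ_{n-1}`. -/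
noncomputable def kernel (a : ℕ → ℂ) (n : ℕ) (z ζ : ℂ) : ℂ :=
  ∑ j ∈ Finset.range n, conj (phi a j z) * phi a j ζ

/-- The factorization is available only on the closed disc, so the derivative at the boundary point
is computed along the radius. -/
theorem deriv_eq_of_sub_eq_mul {u v : ℂ → ℂ} (z : Circle) (hu : DifferentiableAt ℂ u z)
    (hv : ContinuousAt v z) (h : ∀ ζ : ℂ, ‖ζ‖ ≤ 1 → u ζ - u z = (ζ - z) * v ζ) :
    deriv u z = v z := by
  have h2 : Tendsto (fun r : ℝ => (r : ℂ) * z) (𝓝[<] 1) (𝓝[≠] (z : ℂ)) := by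
    refine tendsto_nhdsWithin_iff.2 ⟨?_, ?_⟩
    · have : Continuous (fun r : ℝ => (r : ℂ) * z) := by fun_prop
      simpa using (this.tendsto 1).mono_left nhdsWithin_le_nhds
    · filter_upwards [self_mem_nhdsWithin] with r hr h
      have h1 : (r : ℂ) = 1 := mul_right_cancel₀ (Circle.coe_ne_zero z) (by simpa using h)
      exact (ne_of_lt hr) (by exact_mod_cast h1)
  refine tendsto_nhds_unique ((hasDerivAt_iff_tendsto_slope.1 hu.hasDerivAt).comp h2)
    ((hv.tendsto.comp (h2.mono_right nhdsWithin_le_nhds)).congr' ?_)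
  filter_upwards [Ioo_mem_nhdsLT (show (0 : ℝ) < 1 by norm_num),
    tendsto_nhdsWithin_iff.1 h2 |>.2] with r hr hne
  have h3 : (r : ℂ) * z - z ≠ 0 := sub_ne_zero.2 hne
  rw [Function.comp_apply, Function.comp_apply, slope_def_field,
    h _ (by simp [Circle.norm_coe, abs_of_pos hr.1, hr.2.le]), mul_div_cancel_left₀ _ h3]

theorem norm_one_sub_exp_mul_conj_sq (w : ℂ) (x : ℝ) :
    ‖1 - (Circle.exp x : ℂ) * conj w‖ ^ 2 =
      1 - 2 * ‖w‖ * Real.cos (x - Complex.arg w) + ‖w‖ ^ 2 := by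
  have hw : conj w = ‖w‖ * Complex.exp (-(Complex.arg w * Complex.I)) := by
    conv_lhs => rw [← Complex.norm_mul_exp_arg_mul_I w]
    rw [map_mul, Complex.conj_ofReal, ← Complex.exp_conj]
    simp
  have h1 : (Circle.exp x : ℂ) * conj w =
      ‖w‖ * Complex.exp ((x - Complex.arg w : ℝ) * Complex.I) := by
    rw [hw, Circle.coe_exp, mul_left_comm, ← Complex.exp_add]
    push_cast
    ring_nf
  rw [h1, ← Complex.normSq_eq_norm_sq, Complex.normSq_apply]
  simp only [Complex.sub_re, Complex.sub_im, Complex.one_re, Complex.one_im, Complex.re_ofReal_mul,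
    Complex.im_ofReal_mul, Complex.exp_ofReal_mul_I_re, Complex.exp_ofReal_mul_I_im]
  linear_combination ‖w‖ ^ 2 * Real.sin_sq_add_cos_sq (x - Complex.arg w)

theorem kernel_self (n : ℕ) (z : ℂ) :
    kernel a n z z = ((∑ j ∈ Finset.range n, ‖phi a j z‖ ^ 2 : ℝ) : ℂ) := by
  push_cast
  refine Finset.sum_congr rfl fun j _ => ?_
  rw [mul_comm, Complex.mul_conj, Complex.normSq_eq_norm_sq]
  push_cast
  rfl

section

variable (ha : ∀ k, ‖a k‖ < 1)

include ha

theorem analyticAt_kernel (n : ℕ) (z : ℂ) {ζ : ℂ} (hζ : ‖ζ‖ ≤ 1) :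
    AnalyticAt ℂ (kernel a n z) ζ := by
  have : kernel a n z = fun ζ => ∑ j ∈ Finset.range n, conj (phi a j z) * phi a j ζ := rfl
  rw [this]
  exact Finset.analyticAt_fun_sum _ fun j _ => analyticAt_const.mul (analyticAt_phi ha j hζ)

theorem hasBoundary_kernel (n : ℕ) (z : ℂ) :
    HasBoundary (kernel a n z) (fun t => kernel a n z t) :=
  .of_analyticAt fun _ hζ => analyticAt_kernel ha n z hζ

/-- The Christoffel--Darboux formula. -/
theorem mul_blaschke_sub_blaschke (n : ℕ) (z : Circle) {ζ : ℂ} (hζ : ‖ζ‖ ≤ 1) :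
    z * (blaschke a n ζ - blaschke a n z) = blaschke a n z * ((ζ - z) * kernel a n z ζ) := by
  induction n with
  | zero => simp [kernel]
  | succ n ih =>
    have h1 := one_sub_mul_conj_ne_zero (Circle.norm_coe z).le (ha n)
    have h2 := one_sub_conj_circle_mul_ne_zero z (ha n)
    have h3 := one_sub_mul_conj_ne_zero hζ (ha n)
    have hs := sq_sqrt_one_sub n ha
    have hB := blaschke_mul_conj ha n z
    have hz := circle_mul_conj z
    have hker : kernel a (n + 1) z ζ = kernel a n z ζ + conj (phi a n z) * phi a n ζ := by
      rw [kernel, Finset.sum_range_succ, kernel]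
    have hphi : blaschke a n z * ((z - a n) / (1 - z * conj (a n))) *
        (conj (phi a n z) * phi a n ζ) =
        z * (1 - a n * conj (a n)) * blaschke a n ζ /
          ((1 - z * conj (a n)) * (1 - ζ * conj (a n))) := by
      simp only [phi, map_mul, map_div₀, map_sub, map_one, Complex.conj_conj, Complex.conj_ofReal]
      have h4 : ((z : ℂ) - a n) = z * (1 - conj (z : ℂ) * a n) := by linear_combination a n * hz
      rw [h4]
      generalize blaschke a n ζ = Bζ at *
      generalize blaschke a n (z : ℂ) = Bz at *
      generalize 1 - (z : ℂ) * conj (a n) = d₁ at *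
      generalize 1 - conj (z : ℂ) * a n = d₂ at *
      generalize 1 - ζ * conj (a n) = d₃ at *
      field_simp
      linear_combination Bζ * hs + Bζ * ((Real.sqrt (1 - ‖a n‖ ^ 2) : ℝ) : ℂ) ^ 2 * hB
    rw [hker, blaschke_succ, blaschke_succ, mul_add, mul_add, mul_left_comm _ (ζ - (z : ℂ)) (_ * _),
      hphi]
    have h5 : (ζ - a n) / (1 - ζ * conj (a n)) - (z - a n) / (1 - z * conj (a n)) =
        (1 - a n * conj (a n)) * (ζ - z) / ((1 - z * conj (a n)) * (1 - ζ * conj (a n))) := by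
      rw [div_sub_div _ _ h3 h1, div_eq_div_iff (mul_ne_zero h3 h1) (mul_ne_zero h1 h3)]
      ring
    linear_combination (z - a n) / (1 - z * conj (a n)) * ih + z * blaschke a n ζ * h5

/-- Divided differences stay in the span: that of `B_k` is expanded by Christoffel–Darboux, that of
the Szegő factor is a multiple of the factor. The coefficients do not depend on `n`, and any `n > k`
is allowed, so that the terms of `S_n` share one summation range. -/
theorem exists_phi_sub_phi (k : ℕ) (z : Circle) : ∃ c : ℕ → ℂ, ∀ n, k < n → ∀ ζ : ℂ, ‖ζ‖ ≤ 1 →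
    phi a k ζ - phi a k z = (ζ - z) * ∑ j ∈ Finset.range n, c j * phi a j ζ := by
  set A : ℂ := ((Real.sqrt (1 - ‖a k‖ ^ 2) : ℝ) : ℂ) / (1 - z * conj (a k)) *
    (conj (z : ℂ) * blaschke a k z) with hA
  set b : ℂ := conj (a k) / (1 - z * conj (a k)) with hb
  refine ⟨fun j => if j < k then A * conj (phi a j z) else if j = k then b else 0,
    fun n hn ζ hζ => ?_⟩
  have hsum : ∑ j ∈ Finset.range n,
      (if j < k then A * conj (phi a j z) else if j = k then b else 0) * phi a j ζ =
      A * kernel a k z ζ + b * phi a k ζ := by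
    have h1 : ∀ j, (if j < k then A * conj (phi a j z) else if j = k then b else 0) * phi a j ζ =
        (if j < k then A * (conj (phi a j z) * phi a j ζ) else 0) +
          if j = k then b * phi a k ζ else 0 := by
      intro j
      rcases lt_trichotomy j k with h | h | h
      · simp [h, h.ne]; ring
      · simp [h]
      · simp [h.ne', not_lt.2 h.le]
    simp_rw [h1]
    rw [Finset.sum_add_distrib, Finset.sum_ite_eq' (Finset.range n) k, if_pos (by simpa using hn),
      ← Finset.sum_filter]
    have h2 : (Finset.range n).filter (fun j => j < k) = Finset.range k := by
      ext j; simp only [Finset.mem_filter, Finset.mem_range]; omega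
    rw [h2, ← Finset.mul_sum, kernel]
  rw [hsum]
  have hcd := mul_blaschke_sub_blaschke ha k z hζ
  have hz := circle_mul_conj z
  have h1 := one_sub_mul_conj_ne_zero (Circle.norm_coe z).le (ha k)
  have h3 := one_sub_mul_conj_ne_zero hζ (ha k)
  have hcd' : blaschke a k ζ - blaschke a k z =
      conj (z : ℂ) * (blaschke a k z * ((ζ - z) * kernel a k z ζ)) := by
    linear_combination conj (z : ℂ) * hcd - (blaschke a k ζ - blaschke a k z) * hz
  have h4 : ∀ c : ℂ, c / (1 - ζ * conj (a k)) - c / (1 - z * conj (a k)) =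
      (ζ - z) * (b * (c / (1 - ζ * conj (a k)))) := by
    intro c
    rw [hb, div_sub_div _ _ h3 h1, div_mul_div_comm, ← mul_div_assoc,
      div_eq_div_iff (mul_ne_zero h3 h1) (mul_ne_zero h1 h3)]
    ring
  simp only [phi, hA]
  linear_combination blaschke a k ζ * h4 _ +
    ((Real.sqrt (1 - ‖a k‖ ^ 2) : ℝ) : ℂ) / (1 - z * conj (a k)) * hcd'

theorem exists_partialSum_sub (n : ℕ) (g : Circle → ℂ) (z : Circle) : ∃ c : ℕ → ℂ,
    ∀ ζ : ℂ, ‖ζ‖ ≤ 1 → partialSum a n g ζ - partialSum a n g z =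
      (ζ - z) * ∑ j ∈ Finset.range n, c j * phi a j ζ := by
  choose c hc using fun k => exists_phi_sub_phi ha k z
  refine ⟨fun j => ∑ k ∈ Finset.range n, coeff a g k * c k j, fun ζ hζ => ?_⟩
  simp_rw [Finset.sum_mul]
  rw [Finset.sum_comm, partialSum, partialSum, ← Finset.sum_sub_distrib, Finset.mul_sum]
  refine Finset.sum_congr rfl fun k hk => ?_
  simp_rw [mul_assoc]
  rw [← Finset.mul_sum, ← mul_sub, hc k n (Finset.mem_range.1 hk) ζ hζ]
  ring

/-- Christoffel–Darboux on the diagonal. It turns `B_n / B_n'` into `z / K(z, z)` and gives `|B_n'|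
= ∑ |φ_j|²` on the circle. -/
theorem mul_deriv_blaschke (n : ℕ) (z : Circle) :
    z * deriv (blaschke a n) z = blaschke a n z * kernel a n z z := by
  have hz := circle_mul_conj z
  have h := deriv_eq_of_sub_eq_mul (u := blaschke a n)
    (v := fun ζ => conj (z : ℂ) * (blaschke a n z * kernel a n z ζ)) z
    (analyticAt_blaschke ha n (Circle.norm_coe z).le).differentiableAt
    (continuousAt_const.mul (continuousAt_const.mul
      (analyticAt_kernel ha n z (Circle.norm_coe z).le).continuousAt)) fun ζ hζ => by
        linear_combination conj (z : ℂ) * mul_blaschke_sub_blaschke ha n z hζ -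
          (blaschke a n ζ - blaschke a n z) * hz
  rw [h]
  linear_combination blaschke a n z * kernel a n z z * hz

theorem norm_phi_sq_pos (j : ℕ) (z : Circle) : 0 < ‖phi a j z‖ ^ 2 := by
  have h1 : 0 < 1 - ‖a j‖ ^ 2 := by nlinarith [ha j, norm_nonneg (a j)]
  have h2 := one_sub_mul_conj_ne_zero (Circle.norm_coe z).le (ha j)
  have h3 := blaschke_circle_ne_zero ha j z
  have h4 : ((Real.sqrt (1 - ‖a j‖ ^ 2) : ℝ) : ℂ) ≠ 0 := by
    exact_mod_cast (Real.sqrt_pos.2 h1).ne'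
  have : phi a j z ≠ 0 := mul_ne_zero (div_ne_zero h4 h2) h3
  positivity

theorem sum_norm_phi_sq_pos {n : ℕ} (hn : n ≠ 0) (z : Circle) :
    0 < ∑ j ∈ Finset.range n, ‖phi a j z‖ ^ 2 :=
  Finset.sum_pos (fun j _ => norm_phi_sq_pos ha j z) (Finset.nonempty_range_iff.2 hn)

/-! ### The phase of the Blaschke product and Rusak's kernel -/

theorem gamma_eq (n : ℕ) (x : ℝ) :
    gamma a n x = 1 / 2 * ∑ j ∈ Finset.range n, ‖phi a j (Circle.exp x)‖ ^ 2 := by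
  rw [gamma]
  congr 1
  refine Finset.sum_congr rfl fun j _ => ?_
  have h1 : 0 ≤ 1 - ‖a j‖ ^ 2 := by nlinarith [ha j, norm_nonneg (a j)]
  rw [phi, norm_mul, norm_blaschke_circle ha, mul_one, norm_div, div_pow,
    norm_one_sub_exp_mul_conj_sq, Complex.norm_real, Real.norm_eq_abs, sq_abs, Real.sq_sqrt h1]

theorem kernel_self_exp (n : ℕ) (x : ℝ) :
    kernel a n (Circle.exp x) (Circle.exp x) = 2 * gamma a n x := by
  rw [kernel_self, gamma_eq ha]
  push_cast
  ring

theorem continuous_gamma (n : ℕ) : Continuous (gamma a n) := by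
  have : gamma a n = fun x => 1 / 2 * ∑ j ∈ Finset.range n, ‖phi a j (Circle.exp x)‖ ^ 2 :=
    funext fun x => gamma_eq ha n x
  rw [this]
  refine continuous_const.mul (continuous_finsetSum _ fun j _ => ?_)
  have : Continuous fun t : Circle => phi a j t := continuous_iff_continuousAt.2 fun t =>
    (analyticAt_phi ha j (Circle.norm_coe t).le).continuousAt.comp
      continuous_circle_coe.continuousAt
  exact (this.comp Circle.exp.continuous).norm.pow 2

theorem hasDerivAt_blaschke_exp (n : ℕ) (y : ℝ) :
    HasDerivAt (fun y : ℝ => blaschke a n (Circle.exp y))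
      (2 * gamma a n y * Complex.I * blaschke a n (Circle.exp y)) y := by
  have h0 : HasDerivAt (fun θ : ℝ => (θ : ℂ) * Complex.I) Complex.I y := by
    simpa using (Complex.ofRealCLM.hasDerivAt (x := y)).mul_const Complex.I
  have h1 : HasDerivAt (fun y : ℝ => (Circle.exp y : ℂ)) (Circle.exp y * Complex.I) y := h0.cexp
  have h2 : HasDerivAt (blaschke a n) (deriv (blaschke a n) (Circle.exp y)) (Circle.exp y : ℂ) :=
    (analyticAt_blaschke ha n (Circle.norm_coe _).le).differentiableAt.hasDerivAt
  have h3 := h2.comp y h1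
  have h4 := mul_deriv_blaschke ha n (Circle.exp y)
  rw [kernel_self_exp ha] at h4
  refine h3.congr_deriv ?_
  linear_combination Complex.I * h4

/-- Both sides solve the same linear differential equation in `y`, with logarithmic derivative `2 i
γ_n`, and agree at `y = x`. -/
theorem blaschke_exp_eq (n : ℕ) (x y : ℝ) : blaschke a n (Circle.exp y) =
    blaschke a n (Circle.exp x) * Complex.exp (Complex.I * (2 * ∫ t in x..y, gamma a n t : ℝ)) := by
  have hd : ∀ y : ℝ, HasDerivAt (fun y : ℝ => blaschke a n (Circle.exp y) *
      Complex.exp (-(Complex.I * (2 * ∫ t in x..y, gamma a n t : ℝ)))) 0 y := by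
    intro y
    have h1 : HasDerivAt (fun y : ℝ => 2 * ∫ t in x..y, gamma a n t) (2 * gamma a n y) y :=
      ((continuous_gamma ha n).integral_hasStrictDerivAt x y).hasDerivAt.const_mul 2
    have h2 := ((h1.ofReal_comp.const_mul Complex.I).neg).cexp
    refine ((hasDerivAt_blaschke_exp ha n y).mul h2).congr_deriv ?_
    push_cast
    ring
  have hc := is_const_of_deriv_eq_zero (fun y => (hd y).differentiableAt) (fun y => (hd y).deriv) y x
  simp only [intervalIntegral.integral_same, mul_zero, Complex.ofReal_zero, neg_zero,
    Complex.exp_zero, mul_one] at hc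
  rw [← hc, mul_assoc, ← Complex.exp_add]
  simp

/-- Take moduli in Christoffel–Darboux: both chords, between the points and between their images
under `B_n`, are twice the absolute sine of half the angle. -/
theorem sin_sq_div_sin_sq (n : ℕ) {x y : ℝ} (hxy : Circle.exp y ≠ Circle.exp x) :
    Real.sin (∫ t in x..y, gamma a n t) ^ 2 / Real.sin ((y - x) / 2) ^ 2 =
      ‖kernel a n (Circle.exp x) (Circle.exp y)‖ ^ 2 := by
  have h1 : ‖(Circle.exp y : ℂ) - Circle.exp x‖ = 2 * |Real.sin ((y - x) / 2)| := by
    have : (Circle.exp y : ℂ) - Circle.exp x =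
        Circle.exp x * (Complex.exp (Complex.I * ((y - x : ℝ) : ℂ)) - 1) := by
      rw [mul_sub, Circle.coe_exp, Circle.coe_exp, ← Complex.exp_add, mul_one]
      push_cast
      ring_nf
    rw [this, norm_mul, Circle.norm_coe, one_mul, Complex.norm_exp_I_mul_ofReal_sub_one, norm_mul,
      Real.norm_eq_abs, Real.norm_eq_abs, abs_two]
  have h2 : ‖blaschke a n (Circle.exp y) - blaschke a n (Circle.exp x)‖ =
      2 * |Real.sin (∫ t in x..y, gamma a n t)| := by
    rw [blaschke_exp_eq ha n x y, ← mul_sub_one, norm_mul, norm_blaschke_circle ha, one_mul,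
      Complex.norm_exp_I_mul_ofReal_sub_one, norm_mul,
      Real.norm_eq_abs, Real.norm_eq_abs, abs_two, mul_div_cancel_left₀ _ two_ne_zero]
  have h3 := congrArg norm
    (mul_blaschke_sub_blaschke ha n (Circle.exp x) (Circle.norm_coe (Circle.exp y)).le)
  rw [norm_mul, norm_mul, norm_mul, Circle.norm_coe, norm_blaschke_circle ha, h1, h2] at h3
  have h4 : |Real.sin ((y - x) / 2)| ≠ 0 := by
    intro h
    rw [h, mul_zero, norm_eq_zero, sub_eq_zero, Circle.coe_inj] at h1
    exact hxy h1
  have h5 : ‖kernel a n (Circle.exp x) (Circle.exp y)‖ =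
      |Real.sin (∫ t in x..y, gamma a n t)| / |Real.sin ((y - x) / 2)| := by
    rw [eq_div_iff h4]
    linarith
  rw [h5, div_pow, sq_abs, sq_abs]

/-- This is the conjugation symmetry `u ↦ B_n conj (t u)` of the span, applied to the kernel. It
makes `B_n conj K` the boundary function of a holomorphic function vanishing at `0`. Off the
diagonal it follows from Christoffel–Darboux and its conjugate; on the diagonal `K` is real. -/
theorem blaschke_mul_conj_kernel (n : ℕ) (z t : Circle) :
    blaschke a n t * conj (kernel a n z t) =
      t * (blaschke a n z * conj (z : ℂ)) * kernel a n z t := by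
  by_cases h : (t : ℂ) = z
  · rw [h]
    have : conj (kernel a n z z) = kernel a n z z := by rw [kernel_self, Complex.conj_ofReal]
    rw [this]
    linear_combination (-(blaschke a n z * kernel a n z z)) * circle_mul_conj z
  · have hcd := mul_blaschke_sub_blaschke ha n z (Circle.norm_coe t).le
    have hcd' := congrArg conj hcd
    simp only [map_mul, map_sub] at hcd'
    have hz := circle_mul_conj z
    have ht := circle_mul_conj t
    have hBz := blaschke_mul_conj ha n z
    have hBt := blaschke_mul_conj ha n t
    have htz : conj (t : ℂ) - conj (z : ℂ) ≠ 0 := by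
      rw [← map_sub]
      exact (map_ne_zero _).2 (sub_ne_zero.2 h)
    have hBz0 : conj (blaschke a n z) ≠ 0 := right_ne_zero_of_mul_eq_one hBz
    refine mul_left_cancel₀ (mul_ne_zero hBz0 htz) ?_
    have e1 : conj (t : ℂ) - conj (z : ℂ) = (z - t) * (conj (t : ℂ) * conj (z : ℂ)) := by
      linear_combination (-conj (t : ℂ)) * hz + conj (z : ℂ) * ht
    have e2 : conj (blaschke a n z) * ((conj (t : ℂ) - conj (z : ℂ)) *
        (blaschke a n t * conj (kernel a n z t))) =
        conj (z : ℂ) * (1 - blaschke a n t * conj (blaschke a n z)) := by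
      linear_combination (-blaschke a n t) * hcd' + conj (z : ℂ) * hBt
    have e3 : conj (blaschke a n z) * (conj (t : ℂ) - conj (z : ℂ)) *
        (t * (blaschke a n z * conj (z : ℂ)) * kernel a n z t) =
        conj (z : ℂ) * (1 - blaschke a n t * conj (blaschke a n z)) := by
      rw [e1]
      have e4 : (t - z) * kernel a n z t =
          z * conj (blaschke a n z) * (blaschke a n t - blaschke a n z) := by
        linear_combination (-conj (blaschke a n z)) * hcd - (t - z) * kernel a n z t * hBz
      have e5 : conj (blaschke a n z) * ((z - t) * (conj (t : ℂ) * conj (z : ℂ))) *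
        (t * (blaschke a n z * conj (z : ℂ)) * kernel a n z t) =
        -(blaschke a n z * conj (blaschke a n z)) * (t * conj (t : ℂ)) * conj (z : ℂ) ^ 2 *
          ((t - z) * kernel a n z t) := by ring
      rw [e5, hBz, ht, e4]
      linear_combination (-conj (z : ℂ) * conj (blaschke a n z) *
        (blaschke a n t - blaschke a n z)) * hz + conj (z : ℂ) * hBz
    rw [mul_assoc, e2, e3]

theorem integral_sum_phi_mul_conj_kernel (n : ℕ) (c : ℕ → ℂ) (z : ℂ) :
    ∫ t : Circle, (∑ j ∈ Finset.range n, c j * phi a j t) * conj (kernel a n z t) ∂circleMeasure =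
      ∑ j ∈ Finset.range n, c j * phi a j z := by
  have hs : HasBoundary (fun ζ => ∑ j ∈ Finset.range n, c j * phi a j ζ)
      (fun t => ∑ j ∈ Finset.range n, c j * phi a j t) :=
    HasBoundary.sum _ fun j _ => (hasBoundary_phi ha j).const_mul _
  have : ∀ t : Circle, (∑ j ∈ Finset.range n, c j * phi a j t) * conj (kernel a n z t) =
      ∑ k ∈ Finset.range n, phi a k z *
        ((∑ j ∈ Finset.range n, c j * phi a j t) * conj (phi a k t)) := by
    intro t
    rw [kernel, map_sum, Finset.mul_sum]
    refine Finset.sum_congr rfl fun k _ => ?_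
    rw [map_mul, Complex.conj_conj]
    ring
  simp_rw [this]
  rw [integral_finsetSum _ fun k _ =>
    (hs.integrable_mul_conj (hasBoundary_phi ha k)).const_mul _]
  refine Finset.sum_congr rfl fun k hk => ?_
  rw [integral_const_mul, integral_sum_phi_mul_conj_phi ha, if_pos (Finset.mem_range.1 hk)]
  ring

/-- By the symmetry above, `B_n H |K|²` is the boundary function of a holomorphic function vanishing
at `0`, so only `S_n` contributes. Write `S_n(t) = S_n(z) + (t - z) D(t)` with `D` in the span and
`D(z) = S_n'(z)`. As `(t - z) |K|² = t K - z conj K`, the term `t D K` integrates to zero and the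
reproducing property evaluates the others. -/
theorem integral_mul_kernel_sq {g H : Circle → ℂ} {h : ℂ → ℂ} {n : ℕ} (hH : HasBoundary h H)
    (heq : ∀ᵐ t : Circle ∂circleMeasure, g t = partialSum a n g t + blaschke a n t * H t)
    (z : Circle) :
    ∫ t : Circle, g t * (kernel a n z t * conj (kernel a n z t)) ∂circleMeasure =
      kernel a n z z * partialSum a n g z - z * deriv (partialSum a n g) z := by
  obtain ⟨c, hc⟩ := exists_partialSum_sub ha n g z
  have hD : HasBoundary (fun ζ => ∑ j ∈ Finset.range n, c j * phi a j ζ)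
      (fun t => ∑ j ∈ Finset.range n, c j * phi a j t) :=
    HasBoundary.sum _ fun j _ => (hasBoundary_phi ha j).const_mul _
  have hder := deriv_eq_of_sub_eq_mul (u := partialSum a n g) z
    (analyticAt_partialSum ha n g (Circle.norm_coe z).le).differentiableAt
    (v := fun ζ => ∑ j ∈ Finset.range n, c j * phi a j ζ)
    (Finset.analyticAt_fun_sum (Finset.range n) fun j _ => analyticAt_const.mul
      (analyticAt_phi ha j (Circle.norm_coe z).le)).continuousAt hc
  have hK := hasBoundary_kernel ha n z
  have hzero := HasBoundary.id.mul (((hH.mul (hK.mul hK)).const_mul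
    (blaschke a n z * conj (z : ℂ))).add (hD.mul hK))
  have hpt : ∀ᵐ t : Circle ∂circleMeasure, g t * (kernel a n z t * conj (kernel a n z t)) =
      t * (blaschke a n z * conj (z : ℂ) * (H t * (kernel a n z t * kernel a n z t)) +
        (∑ j ∈ Finset.range n, c j * phi a j t) * kernel a n z t) +
      (partialSum a n g z * (kernel a n z t * conj (kernel a n z t)) -
        z * ((∑ j ∈ Finset.range n, c j * phi a j t) * conj (kernel a n z t))) := by
    filter_upwards [heq] with t ht
    have h1 := hc t (Circle.norm_coe t).le
    have h2 := blaschke_mul_conj_kernel ha n z t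
    have hz := circle_mul_conj z
    have hBz := blaschke_mul_conj ha n z
    have hcd := mul_blaschke_sub_blaschke ha n z (Circle.norm_coe t).le
    generalize (∑ j ∈ Finset.range n, c j * phi a j t) = D at *
    have h3 : (t - z) * kernel a n z t =
        z * conj (blaschke a n z) * (blaschke a n t - blaschke a n z) := by
      linear_combination (-conj (blaschke a n z)) * hcd - (t - z) * kernel a n z t * hBz
    have h4 : (t - z) * kernel a n z t * conj (kernel a n z t) =
        t * kernel a n z t - z * conj (kernel a n z t) := by
      rw [h3]
      linear_combination z * conj (blaschke a n z) * h2 +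
        (t * kernel a n z t * (z * conj (z : ℂ)) - z * conj (kernel a n z t)) * hBz +
        t * kernel a n z t * hz
    rw [ht]
    linear_combination H t * kernel a n z t * h2 + kernel a n z t * conj (kernel a n z t) * h1 +
      D * h4
  have hi1 := (hK.integrable_mul_conj hK).const_mul (partialSum a n g z)
  have hi2 := (hD.integrable_mul_conj hK).const_mul (z : ℂ)
  have hi : Integrable (fun t : Circle =>
      partialSum a n g z * (kernel a n z t * conj (kernel a n z t)) -
        z * ((∑ j ∈ Finset.range n, c j * phi a j t) * conj (kernel a n z t))) circleMeasure :=
    hi1.sub hi2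
  rw [integral_congr_ae hpt, integral_add hzero.integrable hi, hzero.integral_eq,
    zero_mul, zero_add, integral_sub hi1 hi2, integral_const_mul, integral_const_mul,
    integral_sum_phi_mul_conj_kernel ha, hder]
  have hself : ∫ t : Circle, kernel a n z t * conj (kernel a n z t) ∂circleMeasure =
      kernel a n z z := integral_sum_phi_mul_conj_kernel ha n (fun j => conj (phi a j z)) z
  rw [hself]
  ring

theorem rusak_integral_eq {g : Circle → ℂ} {n : ℕ}
    (hg : AEStronglyMeasurable g circleMeasure) (z : Circle) :
    ((1 / (2 * Real.pi) : ℝ) : ℂ) * ∫ y in (-Real.pi)..Real.pi, g (Circle.exp y) *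
      ((Real.sin (∫ t in (Complex.arg z)..y, gamma a n t) ^ 2 /
        Real.sin ((y - Complex.arg z) / 2) ^ 2 : ℝ) : ℂ) =
      ∫ t : Circle, g t * (kernel a n z t * conj (kernel a n z t)) ∂circleMeasure := by
  have hK : Continuous fun t : Circle => kernel a n z t := continuous_iff_continuousAt.2 fun t =>
    (analyticAt_kernel ha n z (Circle.norm_coe t).le).continuousAt.comp
      continuous_circle_coe.continuousAt
  have hm : AEStronglyMeasurable
      (fun t : Circle => g t * (kernel a n z t * conj (kernel a n z t))) circleMeasure :=
    hg.mul (hK.mul (Complex.continuous_conj.comp hK)).aestronglyMeasurable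
  rw [integral_circleMeasure hm]
  congr 1
  refine intervalIntegral.integral_congr_ae ?_
  -- At `y = arg z` the sine quotient is `0 / 0 = 0` rather than the kernel value, but this is a
  -- null set.
  have hne : ∀ᵐ y : ℝ, y ≠ Complex.arg z := by
    simp [ae_iff, measure_singleton]
  filter_upwards [hne] with y hy hmem
  rw [uIoc_of_le (by linarith [Real.pi_pos])] at hmem
  have hxy : Circle.exp y ≠ Circle.exp (Complex.arg z) := by
    intro h
    have := congrArg (fun t : Circle => Complex.arg t) h
    simp only [Circle.exp_arg] at this
    rw [Circle.arg_exp hmem.1 hmem.2] at this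
    exact hy this
  rw [sin_sq_div_sin_sq ha n hxy, Circle.exp_arg, Complex.mul_conj, Complex.normSq_eq_norm_sq]

/-- On boundary functions of bounded holomorphic functions, Rusak's operator coincides with
`σ⁺_{n,φ}`. -/
theorem sigma_eq_sigmaPlus {g H : Circle → ℂ} {h : ℂ → ℂ} {n : ℕ}
    (hg : AEStronglyMeasurable g circleMeasure) (hH : HasBoundary h H)
    (heq : ∀ᵐ t : Circle ∂circleMeasure, g t = partialSum a n g t + blaschke a n t * H t) :
    sigma a n g = sigmaPlus a n g := by
  ext z
  by_cases hn : n = 0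
  · simp [sigma, sigmaPlus, rusakAt, hn, Circle.exp_arg]
  rw [sigma, rusakAt, sigmaPlus, if_neg hn, if_neg hn]
  have h1 := rusak_integral_eq ha (n := n) hg z
  rw [integral_mul_kernel_sq ha hH heq] at h1
  have hker := kernel_self_exp ha n (Complex.arg z)
  rw [Circle.exp_arg] at hker
  have hpos := sum_norm_phi_sq_pos ha hn z
  have hk0 : kernel a n z z ≠ 0 := by
    rw [kernel_self]
    exact_mod_cast hpos.ne'
  have hg0 : (gamma a n (Complex.arg z) : ℂ) ≠ 0 := by
    intro h
    rw [hker, h, mul_zero] at hk0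
    exact hk0 rfl
  have hpi : (Real.pi : ℂ) ≠ 0 := by exact_mod_cast Real.pi_ne_zero
  have hB := mul_deriv_blaschke ha n z
  have hB0 := blaschke_circle_ne_zero ha n z
  have hz0 := Circle.coe_ne_zero z
  have hd0 : deriv (blaschke a n) z ≠ 0 := by
    intro h
    rw [h, mul_zero] at hB
    exact mul_ne_zero hB0 hk0 hB.symm
  have hBd : blaschke a n z / deriv (blaschke a n) z = z / kernel a n z z := by
    rw [div_eq_div_iff hd0 hk0, hB]
  rw [hBd]
  generalize (∫ y in (-Real.pi)..Real.pi, g (Circle.exp y) *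
    ((Real.sin (∫ t in (Complex.arg z)..y, gamma a n t) ^ 2 /
        Real.sin ((y - Complex.arg z) / 2) ^ 2 : ℝ) : ℂ)) = J at *
  have h2 : ((1 / (4 * Real.pi * gamma a n (Complex.arg z)) : ℝ) : ℂ) * J =
      (((1 / (2 * Real.pi) : ℝ) : ℂ) * J) / kernel a n z z := by
    rw [hker]
    push_cast
    field_simp
    ring
  rw [h2, h1]
  field_simp

end

/-! ### Divergent Blaschke sums, derivative estimates and constancy -/

theorem norm_blaschke_factor_sq_le {z w : ℂ} (hz : ‖z‖ < 1) (hw : ‖w‖ < 1) :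
    ‖(z - w) / (1 - z * conj w)‖ ^ 2 ≤ 1 - (1 - ‖z‖ ^ 2) / 4 * (1 - ‖w‖) := by
  have h0 := norm_pos_iff.2 (one_sub_mul_conj_ne_zero hz.le hw)
  have hid : ‖1 - z * conj w‖ ^ 2 - ‖z - w‖ ^ 2 = (1 - ‖z‖ ^ 2) * (1 - ‖w‖ ^ 2) := by
    simp only [← Complex.normSq_eq_norm_sq, Complex.normSq_apply, Complex.sub_re, Complex.sub_im,
      Complex.mul_re, Complex.mul_im, Complex.conj_re, Complex.conj_im, Complex.one_re,
      Complex.one_im]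
    ring
  have h2 : ‖1 - z * conj w‖ ≤ 2 := by
    refine (norm_sub_le _ _).trans ?_
    rw [norm_one, norm_mul, RCLike.norm_conj]
    nlinarith [norm_nonneg z, norm_nonneg w]
  have h4 : ‖1 - z * conj w‖ ^ 2 ≤ 4 := by nlinarith
  rw [norm_div, div_pow, div_le_iff₀ (by positivity)]
  have hz' : 0 ≤ 1 - ‖z‖ ^ 2 := by nlinarith [norm_nonneg z]
  have hw' : 0 ≤ 1 - ‖w‖ := by linarith
  have h5 : (1 - ‖z‖ ^ 2) / 4 * (1 - ‖w‖) * ‖1 - z * conj w‖ ^ 2 ≤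
      (1 - ‖z‖ ^ 2) / 4 * (1 - ‖w‖) * 4 := by gcongr
  have h6 : (1 - ‖z‖ ^ 2) * (1 - ‖w‖) ≤ (1 - ‖z‖ ^ 2) * (1 - ‖w‖ ^ 2) := by
    gcongr
    nlinarith [norm_nonneg w]
  linarith

section

variable (ha : ∀ k, ‖a k‖ < 1)

include ha

/-- If the Blaschke condition fails, the finite Blaschke products tend to `0` in the disc. -/
theorem tendsto_blaschke_zero (hs : ¬ Summable (fun k => 1 - ‖a k‖)) {z : ℂ} (hz : ‖z‖ < 1) :
    Tendsto (fun n => blaschke a n z) atTop (𝓝 0) := by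
  have hsum := (not_summable_iff_tendsto_nat_atTop_of_nonneg
    (fun k => sub_nonneg.2 (ha k).le)).1 hs
  have hz' : 0 < (1 - ‖z‖ ^ 2) / 4 := by nlinarith [norm_nonneg z]
  have hbound : ∀ n, ‖blaschke a n z‖ ^ 2 ≤
      Real.exp (-((1 - ‖z‖ ^ 2) / 4 * ∑ k ∈ Finset.range n, (1 - ‖a k‖))) := by
    intro n
    rw [blaschke, norm_prod, ← Finset.prod_pow, Finset.mul_sum, ← Finset.sum_neg_distrib,
      Real.exp_sum]
    refine Finset.prod_le_prod (fun _ _ => by positivity) fun k _ => ?_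
    refine (norm_blaschke_factor_sq_le hz (ha k)).trans ?_
    linarith [Real.add_one_le_exp (-((1 - ‖z‖ ^ 2) / 4 * (1 - ‖a k‖)))]
  have hlim : Tendsto (fun n => ‖blaschke a n z‖ ^ 2) atTop (𝓝 0) :=
    squeeze_zero (fun _ => by positivity) hbound (Real.tendsto_exp_neg_atTop_nhds_zero.comp
      (hsum.const_mul_atTop hz'))
  have := (Real.continuous_sqrt.tendsto 0).comp hlim
  rw [Real.sqrt_zero] at this
  refine tendsto_zero_iff_norm_tendsto_zero.2 (this.congr fun n => ?_)
  simp [Real.sqrt_sq (norm_nonneg _)]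

/-- The source of the factor `n`: the integrand equals `|B_n'|` on the circle. -/
theorem integral_sum_norm_phi_sq (n : ℕ) :
    Integrable (fun t : Circle => ∑ j ∈ Finset.range n, ‖phi a j t‖ ^ 2) circleMeasure ∧
      ∫ t : Circle, ∑ j ∈ Finset.range n, ‖phi a j t‖ ^ 2 ∂circleMeasure = n := by
  have hpt : ∀ j (t : Circle), phi a j t * conj (phi a j t) = ((‖phi a j t‖ ^ 2 : ℝ) : ℂ) := by
    intro j t
    rw [Complex.mul_conj, Complex.normSq_eq_norm_sq]
  have hi : ∀ j, Integrable (fun t : Circle => ‖phi a j t‖ ^ 2) circleMeasure := by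
    intro j
    have := ((hasBoundary_phi ha j).integrable_mul_conj (hasBoundary_phi ha j)).norm
    refine this.congr (Eventually.of_forall fun t => ?_)
    simp [sq]
  refine ⟨integrable_finsetSum _ fun j _ => hi j, ?_⟩
  rw [integral_finsetSum _ fun j _ => hi j]
  have h1 : ∀ j, ∫ t : Circle, ‖phi a j t‖ ^ 2 ∂circleMeasure = 1 := by
    intro j
    have h := integral_phi_mul_conj_phi_self ha j
    simp_rw [hpt] at h
    rw [integral_complex_ofReal] at h
    exact_mod_cast h
  simp [h1]

theorem norm_deriv_blaschke (n : ℕ) (t : Circle) :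
    ‖deriv (blaschke a n) t‖ = ∑ j ∈ Finset.range n, ‖phi a j t‖ ^ 2 := by
  have h := congrArg norm (mul_deriv_blaschke ha n t)
  rw [norm_mul, norm_mul, Circle.norm_coe, norm_blaschke_circle ha, one_mul, one_mul,
    kernel_self, Complex.norm_real, Real.norm_of_nonneg (by positivity)] at h
  exact h

omit ha in
theorem HasBoundary.norm_le_integral {u : ℂ → ℂ} {U : Circle → ℂ} (hu : HasBoundary u U) {w : ℂ}
    (hw : ‖w‖ < 1) : (1 - ‖w‖ ^ 2) * ‖u w‖ ≤ ∫ t, ‖U t‖ ∂circleMeasure := by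
  -- Cauchy's formula is applied to `u(z) (1 - z conj w)`: on the circle the extra factor cancels
  -- the modulus of the Szegő kernel, and at `w` it equals `1 - |w|²`.
  have h := (hu.mul ((HasBoundary.const 1).sub
    (HasBoundary.id.mul (HasBoundary.const (conj w))))).integral_cauchy hw
  have hpos : 0 ≤ 1 - ‖w‖ ^ 2 := by nlinarith [norm_nonneg w]
  have h1 : ‖u w * (1 - w * conj w)‖ = (1 - ‖w‖ ^ 2) * ‖u w‖ := by
    rw [norm_mul, Complex.mul_conj, Complex.normSq_eq_norm_sq, ← Complex.ofReal_one,
      ← Complex.ofReal_sub, Complex.norm_real, Real.norm_of_nonneg hpos, mul_comm]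
  rw [← h1, ← h]
  refine (norm_integral_le_integral_norm _).trans_eq (integral_congr_ae
    (Eventually.of_forall fun t => ?_))
  have h2 := norm_ne_zero_iff.2 (one_sub_mul_conj_ne_zero (Circle.norm_coe t).le hw)
  simp only [norm_mul, RCLike.norm_conj, norm_div, norm_one]
  field_simp

/-- The derivative of a bounded holomorphic function, corrected by the remainder of its partial
Takenaka--Malmquist sum, is controlled by the distance of its boundary function to `σ⁺_{n,φ}`. -/
theorem HasBoundary.norm_deriv_sub_le {f h : ℂ → ℂ} {g H : Circle → ℂ} {n : ℕ} (hn : n ≠ 0)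
    (hH : HasBoundary h H)
    (hfh : ∀ z ∈ ball (0 : ℂ) 1, f z = partialSum a n g z + blaschke a n z * h z)
    (heq : ∀ᵐ t : Circle ∂circleMeasure, g t = partialSum a n g t + blaschke a n t * H t)
    {N : ℝ} (hN : ∀ᵐ t : Circle ∂circleMeasure, ‖g t - sigmaPlus a n g t‖ ≤ N) {w : ℂ}
    (hw : ‖w‖ < 1) :
    (1 - ‖w‖ ^ 2) * ‖deriv f w - blaschke a n w * deriv h w‖ ≤ n * N := by
  have hF := (hH.mul (HasBoundary.of_analyticAt fun z hz =>
    (analyticAt_blaschke ha n hz).deriv)).add (HasBoundary.of_analyticAt fun z hz =>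
    (analyticAt_partialSum ha n g hz).deriv)
  have hwb : w ∈ ball (0 : ℂ) 1 := by simpa using hw
  have hder : deriv f w - blaschke a n w * deriv h w =
      h w * deriv (blaschke a n) w + deriv (partialSum a n g) w := by
    have h1 := (analyticAt_partialSum ha n g hw.le).differentiableAt.hasDerivAt
    have h2 := (analyticAt_blaschke ha n hw.le).differentiableAt.hasDerivAt
    have h3 := (hH.1.1.differentiableAt (isOpen_ball.mem_nhds hwb)).hasDerivAt
    have h4 : f =ᶠ[𝓝 w] fun z => partialSum a n g z + blaschke a n z * h z :=
      Filter.eventuallyEq_of_mem (isOpen_ball.mem_nhds hwb) hfh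
    rw [((h1.add (h2.mul h3)).congr_of_eventuallyEq h4).deriv]
    ring
  rw [hder]
  refine (hF.norm_le_integral hw).trans ?_
  obtain ⟨hi, hint⟩ := integral_sum_norm_phi_sq ha n
  calc ∫ t : Circle, ‖H t * deriv (blaschke a n) t + deriv (partialSum a n g) t‖ ∂circleMeasure
      ≤ ∫ t : Circle, N * ∑ j ∈ Finset.range n, ‖phi a j t‖ ^ 2 ∂circleMeasure := by
        refine integral_mono_ae hF.integrable.norm (hi.const_mul N) ?_
        filter_upwards [heq, hN] with t h1 h2
        have hd := norm_deriv_blaschke ha n t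
        have hd0 : deriv (blaschke a n) t ≠ 0 := by
          rw [← norm_ne_zero_iff, hd]
          exact (sum_norm_phi_sq_pos ha hn t).ne'
        have hB := norm_blaschke_circle ha n t
        rw [sigmaPlus, if_neg hn] at h2
        -- The error of `σ⁺` is `B_n / B_n'` times the boundary function of `h B_n' + S_n'`, so the
        -- pointwise bound `N` on it yields the integrable bound `N |B_n'|`.
        have h3 : g t - (partialSum a n g t - blaschke a n t / deriv (blaschke a n) t *
            deriv (partialSum a n g) t) = blaschke a n t / deriv (blaschke a n) t *
            (H t * deriv (blaschke a n) t + deriv (partialSum a n g) t) := by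
          generalize deriv (blaschke a n) (t : ℂ) = d at *
          rw [h1]
          field_simp
          ring
        rw [h3, norm_mul, norm_div, hB, hd, one_div_mul_eq_div,
          div_le_iff₀ (sum_norm_phi_sq_pos ha hn t)] at h2
        exact h2
    _ = n * N := by rw [integral_const_mul, hint, mul_comm]

omit ha in
theorem ae_norm_le_of_eLpNorm_top {G : Circle → ℂ} (h : eLpNorm G ∞ circleMeasure ≠ ∞) :
    ∀ᵐ t : Circle ∂circleMeasure, ‖G t‖ ≤ (eLpNorm G ∞ circleMeasure).toReal := by
  rw [eLpNorm_exponent_top] at *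
  filter_upwards [ae_le_eLpNormEssSup (f := G) (μ := circleMeasure)] with t ht
  have := ENNReal.toReal_mono h ht
  simpa using this

theorem MemHInfty.deriv_eq_zero {f : ℂ → ℂ} (hf : MemHInfty f)
    (hs : ¬ Summable (fun k => 1 - ‖a k‖))
    (hlim : Tendsto (fun n : ℕ => (n : ℝ≥0∞) * eLpNorm
      (fun t => boundary f t - sigma a n (boundary f) t) ∞ circleMeasure) atTop (𝓝 0))
    {w : ℂ} (hw : ‖w‖ < 1) : deriv f w = 0 := by
  have hb := hf.hasBoundary
  choose h H hH hfh heq using fun n => hb.exists_eq_partialSum_add ha n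
  obtain ⟨C, hC⟩ := hb.ae_norm_le
  -- On the circle of radius `R` about `w` one has `1 - ‖ζ‖ ≥ R`, so the remainder is at most `C /
  -- R` for every `n`.
  set R : ℝ := (1 - ‖w‖) / 2 with hR
  have hR0 : 0 < R := by simp only [hR]; linarith
  have hC0 : 0 ≤ C := by
    obtain ⟨t, ht⟩ := hC.exists
    exact (norm_nonneg _).trans ht
  have hsub : closedBall w R ⊆ ball 0 1 := by
    intro ζ hζ
    rw [mem_closedBall, dist_eq_norm] at hζ
    have := norm_sub_norm_le ζ w
    rw [mem_ball_zero_iff]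
    simp only [hR] at hζ
    linarith
  have hderiv : ∀ n, ‖deriv (h n) w‖ ≤ C / R / R := by
    intro n
    refine Complex.norm_deriv_le_of_forall_mem_sphere_norm_le hR0
      (((hH n).1.1.mono hsub).diffContOnCl_ball (subset_refl _)) fun ζ hζ => ?_
    have hζ1 := hsub (sphere_subset_closedBall hζ)
    refine ((hH n).norm_remainder_le ha (heq n) hC (by simpa using hζ1)).trans ?_
    rw [mem_sphere, dist_eq_norm] at hζ
    have := norm_sub_norm_le ζ w
    gcongr
    simp only [hR] at hζ ⊢
    linarith
  have hBh : Tendsto (fun n => blaschke a n w * deriv (h n) w) atTop (𝓝 0) := by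
    refine squeeze_zero_norm (a := fun n => ‖blaschke a n w‖ * (C / R / R)) (fun n => ?_) ?_
    · rw [norm_mul]
      exact mul_le_mul_of_nonneg_left (hderiv n) (norm_nonneg _)
    · simpa using (tendsto_blaschke_zero ha hs hw).norm.mul_const (C / R / R)
  have hlim1 : Tendsto (fun n => (1 - ‖w‖ ^ 2) * ‖deriv f w - blaschke a n w * deriv (h n) w‖) atTop
      (𝓝 ((1 - ‖w‖ ^ 2) * ‖deriv f w - 0‖)) :=
    ((tendsto_const_nhds.sub hBh).norm).const_mul _
  have hlim2 := (ENNReal.tendsto_toReal ENNReal.zero_ne_top).comp hlim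
  have hle : ∀ᶠ n : ℕ in atTop, (1 - ‖w‖ ^ 2) * ‖deriv f w - blaschke a n w * deriv (h n) w‖ ≤
      ((n : ℝ≥0∞) * eLpNorm (fun t => boundary f t - sigma a n (boundary f) t) ∞
        circleMeasure).toReal := by
    -- A finite product forces a finite norm only for `n ≠ 0`, because `0 * ∞ = 0` in `ℝ≥0∞`.
    filter_upwards [eventually_ne_atTop 0, hlim.eventually_lt_const ENNReal.zero_lt_top]
      with n hn hfin
    have hE : eLpNorm (fun t => boundary f t - sigma a n (boundary f) t) ∞ circleMeasure ≠ ∞ := by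
      intro hE
      rw [hE, ENNReal.mul_top (by exact_mod_cast hn)] at hfin
      exact lt_irrefl _ hfin
    rw [ENNReal.toReal_mul, ENNReal.toReal_natCast]
    have hae := ae_norm_le_of_eLpNorm_top hE
    refine HasBoundary.norm_deriv_sub_le ha hn (hH n) (hfh n) (heq n) ?_ hw
    rw [← sigma_eq_sigmaPlus ha hb.aestronglyMeasurable (hH n) (heq n)]
    exact hae
  have h0 := le_of_tendsto_of_tendsto hlim1 hlim2 hle
  rw [ENNReal.toReal_zero, sub_zero] at h0
  have hpos : 0 < 1 - ‖w‖ ^ 2 := by nlinarith [norm_nonneg w]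
  have h1 : ‖deriv f w‖ ≤ 0 := nonpos_of_mul_nonpos_right h0 hpos
  exact norm_le_zero_iff.1 h1

end

end TM

/-! ### The main theorem -/

theorem mainTheorem9 (f : ℂ → ℂ) (hf : TM.MemHInfty f)
    (a : ℕ → ℂ) (ha : ∀ k, ‖a k‖ < 1) :
    (∀ᵐ t ∂TM.circleMeasure, TM.HasNontangentialLimit f t (TM.boundary f t)) ∧
    (∀ (n : ℕ) (hn : n ≠ 0),
      ENNReal.ofReal (1 / (n : ℝ) *
          (Finset.range n).sup' (Finset.nonempty_range_iff.mpr hn)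
            (fun j => (1 - ‖a j‖ ^ 2) * ‖deriv f (a j)‖)) ≤
        MeasureTheory.eLpNorm
          (fun t => TM.boundary f t - TM.sigmaPlus a n (TM.boundary f) t) ∞ TM.circleMeasure) ∧
    (¬ Summable (fun k => 1 - ‖a k‖) →
      Filter.Tendsto
        (fun n : ℕ => (n : ℝ≥0∞) * MeasureTheory.eLpNorm
          (fun t => TM.boundary f t - TM.sigma a n (TM.boundary f) t) ∞ TM.circleMeasure)
        Filter.atTop (𝓝 0) →
      ∃ c : ℂ, ∀ z ∈ Metric.ball (0 : ℂ) 1, f z = c) := by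
  refine ⟨hf.ae_hasNontangentialLimit, fun n hn => ?_, fun hs hlim => ?_⟩
  · by_cases hE : MeasureTheory.eLpNorm
      (fun t => TM.boundary f t - TM.sigmaPlus a n (TM.boundary f) t) ∞ TM.circleMeasure = ∞
    · rw [hE]; exact le_top
    obtain ⟨h, H, hH, hfh, heq⟩ := hf.hasBoundary.exists_eq_partialSum_add ha n
    refine (ENNReal.ofReal_le_iff_le_toReal hE).2 ?_
    have hn0 : (0 : ℝ) < n := by exact_mod_cast Nat.pos_of_ne_zero hn
    rw [one_div, inv_mul_le_iff₀ hn0]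
    refine Finset.sup'_le _ _ fun j hj => ?_
    -- At the zero `a j` of `B_n` the correction `B_n h'` disappears.
    have := TM.HasBoundary.norm_deriv_sub_le ha hn hH hfh heq
      (TM.ae_norm_le_of_eLpNorm_top hE) (ha j)
    rwa [TM.blaschke_eq_zero (Finset.mem_range.1 hj), zero_mul, sub_zero] at this
  · refine ⟨f 0, fun z hz => ?_⟩
    exact Metric.isOpen_ball.is_const_of_deriv_eq_zero (convex_ball (0 : ℂ) 1).isPreconnected
      hf.differentiableOn (fun w hw => hf.deriv_eq_zero ha hs hlim (by simpa using hw)) hz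
      (Metric.mem_ball_self one_pos)
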